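/- **Rooted trees.** For a finite rooted (non-plane) tree $t=B_+(t_1,\dots,t_k)$, obtained by joining the roots of $t_1,\dots,t_k$ to a new root, let $|t|$ be its number of vertices, $t!=|t|\,t_1!\cdots t_k!$, $\delta_t=\psi^{(k)}(0)\,\delta_{t_1}\cdots\delta_{t_k}$ where $\psi(z)=1/(1-z)$, and let $\alpha(t)$ be the number of rooted trees on the vertex set $\{0,\dots,|t|-1\}$, with root $0$ and labels increasing away from the root, whose underlying rooted tree is $t$. For $u\in[0,1]$ put $$\phi^x_u(t)=\prod_{i=1}^k\int_0^u\phi^y_v(t_i)\,dv,\qquad \phi^y_u(t)=\prod_{i=1}^k\int_u^1\phi^x_v(t_i)\,dv$$ (empty products being $1$), and let $Y_0$ be the formal power series, with sum over all rooted trees, $$Y_0(s)=\sum_{t}\frac{s^{|t|}}{|t|!}\,\alpha(t)\,t!\,\delta_t\int_0^1\phi^x_v(t)\,dv .$$ **The triangular operator.** Let $\mathcal A$ be a unital complex $*$-algebra containing the $*$-algebra $\mathcal B=\mathbb C[x]$ ($x^*=x$) as a unital $*$-subalgebra, and let $E:\mathcal A\to\mathcal B$ be linear with $E(1)=1$ and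 $E(b_1ab_2)=b_1E(a)b_2$ for $b_1,b_2\in\mathcal B$, $a\in\mathcal A$. Let $\kappa:\mathcal A\times\mathcal A\to\mathcal B$ be a bilinear map with $\kappa(ba_1,a_2)=b\,\kappa(a_1,a_2)$, $\kappa(a_1b,a_2)=\kappa(a_1,ba_2)$, $\kappa(a_1,a_2b)=\kappa(a_1,a_2)\,b$, and let $T\in\mathcal A$ be a generalized circular element with covariance $\kappa$: for all $n\ge 0$, all $b_i\in\mathcal B$ and $s_i\in\{1,*\}$, $$E(b_1T^{s_1}\cdots b_{2n}T^{s_{2n}})=\sum_{\sigma}\kappa_\sigma(b_1T^{s_1},\dots,b_{2n}T^{s_{2n}}),\qquad E(b_1T^{s_1}\cdots b_{2n+1}T^{s_{2n+1}})=0,$$ where $\sigma$ runs over the fixed-point-free involutions of $\{1,\dots,2n\}$ without crossings $i<j<\sigma(i)<\sigma(j)$, and $\kappa_\sigma$ is the evaluation of the word by means of $\kappa$, parenthesized according to $\sigma$ (the word $a_1\cdots a_m$ has the value $\kappa(a_1,w\,a_k)\,w'$ with $k=\sigma(1)$ and $w,w'$ the values of $a_2\cdots a_{k-1}$ and $a_{k+1}\cdots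 a_m$; the empty word has the value $1$). Suppose that for all $b\in\mathcal B$ and $x\in[0,1]$ $$[\kappa(T,bT^*)](x)=\int_x^1b(s)\,ds,\quad[\kappa(T^*,bT)](x)=\int_0^xb(s)\,ds,\quad\kappa(T,bT)=\kappa(T^*,bT^*)=0,$$ and let $\tau(a)=\int_0^1[E(a)](s)\,ds$. **Claim.** (1) $Y_0(0)=0$, and with $G(z)=ze^{-z}$ one has, as formal power series, $$G\Big(\frac{s}{1-Y_0(s)}\Big)=s,$$ and the power series $s/(1-Y_0(s))$ and $G$ are inverse to each other with respect to composition (in both orders). (2) For every $n\ge 0$, $\tau\big((TT^*)^n\big)=\dfrac{n^n}{(n+1)!}$ (with $0^0=1$). -/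

import Mathlib

noncomputable section

namespace DykemaHaagerup

/-! ### Rooted trees -/

/-- Finite rooted plane trees: a root together with the ordered list of its subtrees. -/
inductive PlaneTree : Type
  | node : List PlaneTree → PlaneTree

/-- `Swap t t'`: the plane tree `t'` arises from `t` by permuting the children of one vertex.
Two plane trees have the same underlying rooted tree iff they are connected by a chain of
such moves. -/
inductive PlaneTree.Swap : PlaneTree → PlaneTree → Prop
  | root {l l' : List PlaneTree} : l.Perm l' → PlaneTree.Swap (.node l) (.node l')
  | child {t t' : PlaneTree} (l₁ l₂ : List PlaneTree) : PlaneTree.Swap t t' →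
      PlaneTree.Swap (.node (l₁ ++ t :: l₂)) (.node (l₁ ++ t' :: l₂))

/-- (Isomorphism classes of) finite rooted trees: plane trees up to reordering of children. -/
def RTree : Type := Quot PlaneTree.Swap

/-- The number `|t|` of vertices. -/
def PlaneTree.size : PlaneTree → ℕ
  | .node ts => 1 + (ts.map fun t => t.size).sum

/-- The tree factorial: `t! = |t| t₁! ⋯ t_k!` for `t = B₊(t₁, …, t_k)`. -/
def PlaneTree.factorial : PlaneTree → ℕ
  | .node ts => (PlaneTree.node ts).size * (ts.map fun t => t.factorial).prod

/-- The elementary differential `δ_t = ψ⁽ᵏ⁾(0) δ_{t₁} ⋯ δ_{t_k}` for `t = B₊(t₁, …, t_k)`,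
where `ψ⁽ᵏ⁾(0) = k! [zᵏ] ψ(z)`. -/
def PlaneTree.elemDiff (ψ : PowerSeries ℝ) : PlaneTree → ℝ
  | .node ts => (ts.length.factorial : ℝ) * PowerSeries.coeff ts.length ψ *
      (ts.map fun t => t.elemDiff ψ).prod

/-- The iterated integrals. For `t = B₊(t₁, …, t_k)`,
`iter a a' t u = ∏ᵢ ∫₀¹ a(u,v) iter a' a tᵢ v dv`: the two kernels are exchanged from one level of
the tree to the next. Hence, for kernels `aˣ, aʸ`, one has `φˣ_u(t) = iter aˣ aʸ t u` and
`φʸ_u(t) = iter aʸ aˣ t u`. -/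
def PlaneTree.iter : PlaneTree → (ℝ → ℝ → ℝ) → (ℝ → ℝ → ℝ) → ℝ → ℝ
  | .node ts, a, a', u => (ts.map fun t => ∫ v in (0 : ℝ)..1, a u v * t.iter a' a v).prod

theorem PlaneTree.size_swap {t t' : PlaneTree} (h : PlaneTree.Swap t t') : t.size = t'.size := by
  induction h with
  | root h => simp only [PlaneTree.size]; rw [(h.map _).sum_eq]
  | child l₁ l₂ _ ih => simp [PlaneTree.size, ih]

theorem PlaneTree.factorial_swap {t t' : PlaneTree} (h : PlaneTree.Swap t t') :
    t.factorial = t'.factorial := by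
  induction h with
  | root h =>
    simp only [PlaneTree.factorial]
    rw [(h.map _).prod_eq, PlaneTree.size_swap (.root h)]
  | child l₁ l₂ hs ih =>
    simp only [PlaneTree.factorial, PlaneTree.size_swap (.child l₁ l₂ hs)]
    simp [ih]

theorem PlaneTree.elemDiff_swap (ψ : PowerSeries ℝ) {t t' : PlaneTree}
    (h : PlaneTree.Swap t t') : t.elemDiff ψ = t'.elemDiff ψ := by
  induction h with
  | root h => simp only [PlaneTree.elemDiff]; rw [(h.map _).prod_eq, h.length_eq]
  | child l₁ l₂ _ ih => simp [PlaneTree.elemDiff, ih]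

theorem PlaneTree.iter_swap {t t' : PlaneTree} (h : PlaneTree.Swap t t') :
    t.iter = t'.iter := by
  induction h with
  | root h => funext a a' u; simp only [PlaneTree.iter]; rw [(h.map _).prod_eq]
  | child l₁ l₂ _ ih => funext a a' u; simp [PlaneTree.iter, ih]

namespace RTree

/-- The number of vertices of a rooted tree. -/
def size : RTree → ℕ := Quot.lift PlaneTree.size fun _ _ => PlaneTree.size_swap

/-- The tree factorial of a rooted tree. -/
def factorial : RTree → ℕ := Quot.lift PlaneTree.factorial fun _ _ => PlaneTree.factorial_swap

/-- The elementary differentials on rooted trees. -/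
def elemDiff (ψ : PowerSeries ℝ) : RTree → ℝ :=
  Quot.lift (PlaneTree.elemDiff ψ) fun _ _ => PlaneTree.elemDiff_swap ψ

/-- `φˣ_u(t)` for the kernels `aˣ = ax`, `aʸ = ay`. -/
def phiX (ax ay : ℝ → ℝ → ℝ) (u : ℝ) (t : RTree) : ℝ :=
  Quot.lift PlaneTree.iter (fun _ _ => PlaneTree.iter_swap) t ax ay u

end RTree

/-- Rooted labelled trees with `m + 1` vertices: the vertices are labelled `0, …, m`, the root is
`0`, and labels increase away from the root. Such a tree is given by the parent
`p j ∈ {0, …, j}` of each vertex `j + 1`, `0 ≤ j < m`. -/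
abbrev LTree (m : ℕ) : Type := (j : Fin m) → Fin (j.val + 1)

/-- The subtree at vertex `i` of a labelled tree, with the labels forgotten. -/
def LTree.subtree {m : ℕ} (p : LTree m) (i : ℕ) : PlaneTree :=
  .node (((List.finRange m).filter fun j => (p j).val = i).attach.map fun j =>
    LTree.subtree p (j.1.val + 1))
termination_by m - i
decreasing_by
  have h := j.2
  simp only [List.mem_filter, List.mem_finRange, true_and, decide_eq_true_eq] at h
  have _h1 := (p j.1).isLt
  have _h2 := j.1.isLt
  omega

/-- The shape of a labelled tree: the underlying rooted tree. -/
def LTree.shape {m : ℕ} (p : LTree m) : RTree := Quot.mk _ (p.subtree 0)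

/-- `α(t)`: the number of rooted labelled trees of shape `t`. -/
def RTree.alpha (t : RTree) : ℕ := Nat.card {p : LTree (t.size - 1) // p.shape = t}

/-- The `Y`-component of the P-series with zero initial values,
`Y_u(s) = ∑_t s^|t| / |t|! α(t) t! δ_t ∫₀¹ aʸ(u,v) φˣ_v(t) dv`,
summed over all rooted trees, as a formal power series in `s`. (For each `n` there are only finitely
many rooted trees with `n` vertices, so each coefficient is a finite sum.) -/
def seriesY (ψ : PowerSeries ℝ) (ax ay : ℝ → ℝ → ℝ) (u : ℝ) : PowerSeries ℝ :=
  PowerSeries.mk fun n => ∑ᶠ (t : RTree) (_ : t.size = n),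
    1 / (n.factorial : ℝ) * (t.alpha : ℝ) * (t.factorial : ℝ) * t.elemDiff ψ *
      ∫ v in (0 : ℝ)..1, ay u v * t.phiX ax ay v

/-- The kernel `aˣ(u,v) = 1_{[0,u]}(v)`. -/
def kerX (u v : ℝ) : ℝ := (Set.Icc 0 u).indicator (fun _ => 1) v

/-- The kernel `aʸ(u,v) = 1_{[u,1]}(v)`. -/
def kerY (u v : ℝ) : ℝ := (Set.Icc u 1).indicator (fun _ => 1) v

/-- `Y₀(s)` for `ψ(z) = 1/(1-z)` and the kernels `1_{[0,u]}(v)`, `1_{[u,1]}(v)`. -/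
def Y₀ : PowerSeries ℝ := seriesY (1 - PowerSeries.X)⁻¹ kerX kerY 0

/-- `G(z) = z e^{-z}`. -/
def G : PowerSeries ℝ := PowerSeries.X * PowerSeries.evalNegHom (PowerSeries.exp ℝ)

/-! ### Generalized circular elements -/

/-- The set `𝒥(m)` of involutions of `{0, …, m-1}` without fixed points and without crossings
`i < j < σ(i) < σ(j)`. -/
def noncrossing (m : ℕ) : Finset (Equiv.Perm (Fin m)) :=
  Finset.univ.filter fun σ => (∀ i, σ (σ i) = i) ∧ (∀ i, σ i ≠ i) ∧
    ∀ i j, ¬ (i < j ∧ j < σ i ∧ σ i < σ j)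

section OperatorValued

variable {A B : Type*} [Ring A] [Algebra ℂ A] [Ring B] [Algebra ℂ B]

/-- `E : A → B` is a conditional expectation onto the subalgebra `B` of `A` (embedded by `ι`):
linear, unital, and a `B`-bimodule map. -/
structure IsCondExp (ι : B →ₐ[ℂ] A) (E : A →ₗ[ℂ] B) : Prop where
  map_one : E 1 = 1
  bimodule : ∀ (b₁ : B) (a : A) (b₂ : B), E (ι b₁ * a * ι b₂) = b₁ * E a * b₂

/-- The three rules satisfied by the product `a₁ • a₂ = κ(a₁, a₂)`. -/
structure IsBalanced (ι : B →ₐ[ℂ] A) (κ : A →ₗ[ℂ] A →ₗ[ℂ] B) : Prop where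
  left : ∀ (b : B) (a₁ a₂ : A), κ (ι b * a₁) a₂ = b * κ a₁ a₂
  middle : ∀ (a₁ : A) (b : B) (a₂ : A), κ (a₁ * ι b) a₂ = κ a₁ (ι b * a₂)
  right : ∀ (a₁ a₂ : A) (b : B), κ a₁ (a₂ * ι b) = κ a₁ a₂ * b

/-- The value of the part `a_i ⋯ a_{j-1}` of the word `a₀ ⋯ a_{m-1}`, parenthesized by the
noncrossing involution `σ` (of which `{i, …, j-1}` is an invariant interval): if `k = σ(i)`, it is
`κ(a_i, w a_k) w'`, where `w` and `w'` are the values of `a_{i+1} ⋯ a_{k-1}` and of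
`a_{k+1} ⋯ a_{j-1}`, and an empty word has value `1`. The guard `i < σ(i) < j` always holds for
noncrossing `σ` and invariant intervals. -/
def evalWord (ι : B →ₐ[ℂ] A) (κ : A →ₗ[ℂ] A →ₗ[ℂ] B) {m : ℕ} (σ : Equiv.Perm (Fin m))
    (a : Fin m → A) (i j : ℕ) : B :=
  if hi : i < m ∧ i < j then
    if i < (σ ⟨i, hi.1⟩).val ∧ (σ ⟨i, hi.1⟩).val < j then
      κ (a ⟨i, hi.1⟩)
          (ι (evalWord ι κ σ a (i + 1) (σ ⟨i, hi.1⟩).val) * a (σ ⟨i, hi.1⟩)) *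
        evalWord ι κ σ a ((σ ⟨i, hi.1⟩).val + 1) j
    else 0
  else 1
termination_by j - i
decreasing_by all_goals omega

/-- `κ_σ(a₀, …, a_{m-1})`. -/
def kappaPerm (ι : B →ₐ[ℂ] A) (κ : A →ₗ[ℂ] A →ₗ[ℂ] B) {m : ℕ} (σ : Equiv.Perm (Fin m))
    (a : Fin m → A) : B :=
  evalWord ι κ σ a 0 m

/-- The letter `T` (for `false`) or `T*` (for `true`). -/
def letter [StarRing A] (T : A) (s : Bool) : A := if s then star T else T

/-- The word `(b₀ T^{s₀}, …, b_{m-1} T^{s_{m-1}})` with `s_i ∈ {1, *}`. -/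
def word [StarRing A] (ι : B →ₐ[ℂ] A) (T : A) {m : ℕ} (b : Fin m → B) (s : Fin m → Bool) :
    Fin m → A :=
  fun i => ι (b i) * letter T (s i)

/-- `T` is a generalized circular element with covariance `κ`. -/
structure IsGeneralizedCircular [StarRing A] (ι : B →ₐ[ℂ] A) (E : A →ₗ[ℂ] B)
    (κ : A →ₗ[ℂ] A →ₗ[ℂ] B) (T : A) : Prop where
  balanced : IsBalanced ι κ
  even : ∀ (n : ℕ) (b : Fin (2 * n) → B) (s : Fin (2 * n) → Bool),
    E (List.ofFn (word ι T b s)).prod =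
      ∑ σ ∈ noncrossing (2 * n), kappaPerm ι κ σ (word ι T b s)
  odd : ∀ (n : ℕ) (b : Fin (2 * n + 1) → B) (s : Fin (2 * n + 1) → Bool),
    E (List.ofFn (word ι T b s)).prod = 0

end OperatorValued

/-- An operator-valued probability space over the `*`-algebra `ℂ[x]` of complex polynomials
(`x* = x`): a unital `*`-algebra `A`, a unital `*`-embedding `ι : ℂ[x] → A`, and a conditional
expectation `E`. -/
structure IsPolyProbSpace {A : Type*} [Ring A] [StarRing A] [Algebra ℂ A]
    (ι : Polynomial ℂ →ₐ[ℂ] A) (E : A →ₗ[ℂ] Polynomial ℂ) : Prop where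
  injective : Function.Injective ι
  map_star : ∀ b : Polynomial ℂ, ι (b.map (starRingEnd ℂ)) = star (ι b)
  condExp : IsCondExp ι E

/-- `T` is a triangular operator of Dykema and Haagerup: a generalized circular element over
`ℂ[x]` with `κ(T, bT*)(x) = ∫ₓ¹ b`, `κ(T*, bT)(x) = ∫₀ˣ b`, `κ(T, bT) = κ(T*, bT*) = 0`
(polynomials being viewed as functions on `[0,1]`). -/
def IsTriangular {A : Type*} [Ring A] [StarRing A] [Algebra ℂ A]
    (ι : Polynomial ℂ →ₐ[ℂ] A) (E : A →ₗ[ℂ] Polynomial ℂ) (T : A) : Prop :=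
  ∃ κ : A →ₗ[ℂ] A →ₗ[ℂ] Polynomial ℂ, IsGeneralizedCircular ι E κ T ∧
    (∀ (b : Polynomial ℂ), ∀ x ∈ Set.Icc (0 : ℝ) 1,
      (κ T (ι b * star T)).eval (x : ℂ) = ∫ s in x..1, b.eval (s : ℂ)) ∧
    (∀ (b : Polynomial ℂ), ∀ x ∈ Set.Icc (0 : ℝ) 1,
      (κ (star T) (ι b * T)).eval (x : ℂ) = ∫ s in (0 : ℝ)..x, b.eval (s : ℂ)) ∧
    (∀ b : Polynomial ℂ, κ T (ι b * T) = 0) ∧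
    (∀ b : Polynomial ℂ, κ (star T) (ι b * star T) = 0)

/-- The trace `τ(a) = ∫₀¹ E(a)(s) ds`. -/
def trace {A : Type*} [Ring A] [Algebra ℂ A] (E : A →ₗ[ℂ] Polynomial ℂ) (a : A) : ℂ :=
  ∫ s in (0 : ℝ)..1, (E a).eval (s : ℂ)

end DykemaHaagerup

end

/-! Both claims reduce to unweighted sums over plane trees, whose generating functions solve an
explicit pair of differential equations.

For a function that ignores the order of siblings, a sum over labelled trees weighted by `degProd`
and `hook` is `m!` times the plain sum over plane trees with `m + 1` vertices (`LTree.sum_binary`).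
Since `ψ⁽ᵏ⁾(0) = k!`, the weight `α(t) t! δ_t / |t|!` is of exactly this kind, so the coefficients
of `Y₀` are plain sums of iterated integrals over plane trees (`coeff_seriesY`).

Splitting off the first subtree of the root turns these sums into products. With `X_u` and `Y_u` the
series of the integrated sums, `∂X = s/(1-Y)`, `∂Y = -s/(1-X)`, `X(0) = 0`, `Y(1) = 0`
(`coupledSystem_polyIter`). The product `(1-X)(1-Y)` does not depend on `u`; its value is `c = 1 -
Y₀`, and `u = 1` gives `c = 1 - X(1)`. Hence `∂(1-X) = -(s/c)(1-X)`, so `1 - X = exp(-us/c)`, and `u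
= 1` yields `c = exp(-s/c)`. This says that `W = s/c` satisfies `W e^{-W} = s`.

The exponential also satisfies the delay equation `∂(1-X)(u) = -s (1-X)(u-1)`, which determines the
coefficients of `X` as `u(n+1-u)ⁿ/(n+1)!`.

For the operator, decomposing noncrossing pairings of `TT*TT*⋯` by the partner of the first letter
gives the same recursion as splitting off the first subtree. So `E((TT*)ⁿ)` is the `n`-th
coefficient of `1/(1-Y)`, and its integral over `[0,1]` is the value at `1` of the Abel polynomial,
`nⁿ/(n+1)!`. -/

namespace DykemaHaagerup

open BinaryTree

/-! ### Plane trees as binary trees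

The binary tree `nil` stands for the plane tree with one vertex, and `node () l r` for the plane
tree obtained from `r` by making `l` the first child of the root. -/

/-- The sum of `f` over all plane trees with `n + 1` vertices. -/
def treeSum {M : Type*} [AddCommMonoid M] (n : ℕ) (f : BinaryTree Unit → M) : M :=
  ∑ t ∈ treesOfNumNodesEq n, f t

theorem treeSum_zero {M : Type*} [AddCommMonoid M] (f : BinaryTree Unit → M) :
    treeSum 0 f = f nil := by
  simp [treeSum]

/-- Splitting off the first subtree of the root. For multiplicative summands this becomes the
convolution behind the generating functions. -/
theorem treeSum_succ {M : Type*} [AddCommMonoid M] (n : ℕ) (f : BinaryTree Unit → M) :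
    treeSum (n + 1) f = ∑ ij ∈ Finset.HasAntidiagonal.antidiagonal n,
      treeSum ij.1 fun l => treeSum ij.2 fun r => f (node () l r) := by
  rw [treeSum, treesOfNumNodesEq_succ, Finset.sum_biUnion]
  · refine Finset.sum_congr rfl fun ij _ => ?_
    rw [pairwiseNode, Finset.sum_map, Finset.sum_product]
    rfl
  · simp_rw [Set.PairwiseDisjoint, Set.Pairwise, Function.onFun, Finset.disjoint_left]
    rintro ⟨i, j⟩ _ ⟨i', j'⟩ _ hij a ha ha'
    simp only [pairwiseNode, Finset.mem_map, Finset.mem_product, mem_treesOfNumNodesEq] at ha ha'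
    obtain ⟨⟨l, r⟩, ⟨h1, h2⟩, rfl⟩ := ha
    obtain ⟨⟨l', r'⟩, ⟨h1', h2'⟩, h⟩ := ha'
    have h : node () l' r' = node () l r := h
    injection h with _ hl hr
    simp_all

theorem treeSum_mul_treeSum {R : Type*} [NonUnitalNonAssocSemiring R] (m n : ℕ)
    (f g : BinaryTree Unit → R) :
    (treeSum m fun l => treeSum n fun r => f l * g r) = treeSum m f * treeSum n g := by
  simp only [treeSum, Finset.sum_mul_sum]

theorem treeSum_congr {M : Type*} [AddCommMonoid M] {n : ℕ} {f g : BinaryTree Unit → M}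
    (h : ∀ t, t.numNodes = n → f t = g t) : treeSum n f = treeSum n g :=
  Finset.sum_congr rfl fun t ht => h t (mem_treesOfNumNodesEq.1 ht)

theorem treeSum_add (n : ℕ) (f g : BinaryTree Unit → ℝ) :
    (treeSum n fun t => f t + g t) = treeSum n f + treeSum n g :=
  Finset.sum_add_distrib

theorem mul_treeSum (n : ℕ) (c : ℝ) (f : BinaryTree Unit → ℝ) :
    c * treeSum n f = treeSum n fun t => c * f t :=
  Finset.mul_sum _ _ _

theorem treeSum_comm (m n : ℕ) (f : BinaryTree Unit → BinaryTree Unit → ℝ) :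
    (treeSum m fun l => treeSum n fun r => f l r) = treeSum n fun r => treeSum m fun l => f l r :=
  Finset.sum_comm

/-! ### Two ways of enlarging a plane tree by a leaf -/

/-- Adds a new last child to the root. -/
def addLast : BinaryTree Unit → BinaryTree Unit
  | nil => node () nil nil
  | node _ l r => node () l (addLast r)

/-- The sum of `F` over all trees obtained by adding a last child to a vertex other than the
root. -/
def growBelow : BinaryTree Unit → (BinaryTree Unit → ℝ) → ℝ
  | nil, _ => 0
  | node _ l r, F => growBelow l (fun g => F (node () g r)) + F (node () (addLast l) r) +
      growBelow r fun g => F (node () l g)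

/-- The sum of `F` over all trees obtained by adding a last child to a vertex. -/
def grow (t : BinaryTree Unit) (F : BinaryTree Unit → ℝ) : ℝ := growBelow t F + F (addLast t)

/-- The sum of `F` over all trees obtained by inserting a leaf among the children of the root. -/
def insertRoot : BinaryTree Unit → (BinaryTree Unit → ℝ) → ℝ
  | nil, F => F (node () nil nil)
  | node _ l r, F => F (node () nil (node () l r)) + insertRoot r fun g => F (node () l g)

/-- The sum of `F` over all trees obtained by inserting a leaf among the children of a vertex
other than the root. -/
def insertBelow : BinaryTree Unit → (BinaryTree Unit → ℝ) → ℝ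
  | nil, _ => 0
  | node _ l r, F => insertBelow l (fun g => F (node () g r)) +
      insertRoot l (fun g => F (node () g r)) + insertBelow r fun g => F (node () l g)

/-- The sum of `F` over all trees obtained by inserting a leaf among the children of a vertex. -/
def insertLeaf (t : BinaryTree Unit) (F : BinaryTree Unit → ℝ) : ℝ :=
  insertBelow t F + insertRoot t F

/-- The number of children of the root. -/
def rootDeg : BinaryTree Unit → ℕ
  | nil => 0
  | node _ _ r => rootDeg r + 1

/-- The product of the factorials of the numbers of children. -/
def degProd : BinaryTree Unit → ℝ
  | nil => 1
  | node _ l r => (rootDeg r + 1) * degProd l * degProd r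

/-- The product of the sizes of all subtrees at vertices other than the root. -/
def hook : BinaryTree Unit → ℝ
  | nil => 1
  | node _ l r => (l.numNodes + 1) * hook l * hook r

/-! ### Functions invariant under reordering siblings -/

/-- Interchange of two neighbouring siblings. -/
inductive SiblingSwap : BinaryTree Unit → BinaryTree Unit → Prop
  | swap (a b c : BinaryTree Unit) :
      SiblingSwap (node () a (node () b c)) (node () b (node () a c))
  | left {a b : BinaryTree Unit} (c : BinaryTree Unit) (h : SiblingSwap a b) :
      SiblingSwap (node () a c) (node () b c)
  | right {a b : BinaryTree Unit} (c : BinaryTree Unit) (h : SiblingSwap a b) :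
      SiblingSwap (node () c a) (node () c b)

/-- Functions that do not depend on the order of siblings. -/
def Symm (F : BinaryTree Unit → ℝ) : Prop := ∀ ⦃s t⦄, SiblingSwap s t → F s = F t

namespace Symm

variable {F F' : BinaryTree Unit → ℝ}

theorem nodeLeft (h : Symm F) (c : BinaryTree Unit) : Symm fun g => F (node () g c) :=
  fun _ _ hs => h (.left c hs)

theorem nodeRight (h : Symm F) (c : BinaryTree Unit) : Symm fun g => F (node () c g) :=
  fun _ _ hs => h (.right c hs)

theorem mul (h : Symm F) (h' : Symm F') : Symm fun t => F t * F' t :=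
  fun _ _ hs => by simp only [h hs, h' hs]

theorem addLast_eq {F : BinaryTree Unit → ℝ} (h : Symm F) (t : BinaryTree Unit) :
    F (addLast t) = F (node () nil t) := by
  induction t generalizing F with
  | nil => rfl
  | node _ l r _ ih =>
    rw [addLast, ih (h.nodeRight l)]
    exact h (.swap l nil r)

/-- Among `k` siblings there are `k + 1` gaps for the new leaf, and a symmetric `F` does not
distinguish them. -/
theorem insertRoot_eq {F : BinaryTree Unit → ℝ} (h : Symm F) (t : BinaryTree Unit) :
    insertRoot t F = (rootDeg t + 1) * F (node () nil t) := by
  induction t generalizing F with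
  | nil => simp [insertRoot, rootDeg]
  | node _ l r _ ih =>
    rw [insertRoot, ih (h.nodeRight l), h (.swap l nil r), rootDeg]
    push_cast
    ring

end Symm

theorem SiblingSwap.rootDeg_eq {s t : BinaryTree Unit} (h : SiblingSwap s t) :
    rootDeg s = rootDeg t := by
  induction h <;> simp_all [rootDeg]

theorem SiblingSwap.numNodes_eq {s t : BinaryTree Unit} (h : SiblingSwap s t) :
    s.numNodes = t.numNodes := by
  induction h with
  | swap a b c => simp only [numNodes]; omega
  | left c _ ih => simp only [numNodes, ih]
  | right c _ ih => simp only [numNodes, ih]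

theorem symm_hook : Symm hook := by
  intro s t h
  induction h with
  | swap a b c => simp only [hook]; ring
  | left c h ih => simp only [hook, ih, h.numNodes_eq]
  | right c _ ih => simp only [hook, ih]

/-- Symmetry must survive leaf insertion, because the induction in `LTree.sum_binary` is applied to
a function built by inserting leaves. -/
theorem symm_insertBelow {F : BinaryTree Unit → ℝ} (hF : Symm F) :
    Symm fun t => insertBelow t F := by
  intro s t h
  induction h generalizing F with
  | swap a b c =>
    simp only [insertBelow]
    have h1 : (fun g => F (node () a (node () b g))) = fun g => F (node () b (node () a g)) :=
      funext fun g => hF (.swap a b g)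
    have h2 : (fun g => F (node () g (node () b c))) = fun g => F (node () b (node () g c)) :=
      funext fun g => hF (.swap g b c)
    have h3 : (fun g => F (node () g (node () a c))) = fun g => F (node () a (node () g c)) :=
      funext fun g => hF (.swap g a c)
    rw [h1, h2, h3]
    ring
  | @left a b c h ih =>
    simp only [insertBelow] at ih ⊢
    rw [ih (hF.nodeLeft c), (hF.nodeLeft c).insertRoot_eq, (hF.nodeLeft c).insertRoot_eq,
      h.rootDeg_eq, hF (.left c (.right nil h)),
      show (fun g => F (node () a g)) = fun g => F (node () b g) from
        funext fun g => hF (.left g h)]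
  | @right a b c h ih =>
    simp only [insertBelow] at ih ⊢
    rw [ih (hF.nodeRight c),
      show (fun g => F (node () g a)) = fun g => F (node () g b) from
        funext fun g => hF (.right g h)]

theorem symm_insertLeaf {F : BinaryTree Unit → ℝ} (hF : Symm F) :
    Symm fun t => insertLeaf t F := by
  intro s t h
  have hb : insertBelow s F = insertBelow t F := symm_insertBelow hF h
  simp only [insertLeaf]
  rw [hb, hF.insertRoot_eq, hF.insertRoot_eq, h.rootDeg_eq, hF (.right nil h)]

/-! ### The degree weight: last children against arbitrary insertions -/

theorem growBelow_mul (t : BinaryTree Unit) (c : ℝ) (F : BinaryTree Unit → ℝ) :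
    growBelow t (fun g => c * F g) = c * growBelow t F := by
  induction t generalizing F with
  | nil => simp [growBelow]
  | node _ l r ihl ihr => simp only [growBelow, ihl, ihr]; ring

/-- Growth below the root leaves the root degree unchanged, so a weight depending on it can be
frozen at its old value. -/
theorem growBelow_rootDeg (t : BinaryTree Unit) (F : ℕ → BinaryTree Unit → ℝ) :
    growBelow t (fun g => F (rootDeg g) g) = growBelow t (F (rootDeg t)) := by
  induction t generalizing F with
  | nil => rfl
  | node _ l r ihl ihr =>
    simp only [growBelow, rootDeg]
    rw [ihr fun n g => F (n + 1) (node () l g)]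

theorem insertBelow_mul (t : BinaryTree Unit) (c : ℝ) (F : BinaryTree Unit → ℝ) :
    insertBelow t (fun g => c * F g) = c * insertBelow t F ∧
      insertRoot t (fun g => c * F g) = c * insertRoot t F := by
  induction t generalizing F with
  | nil => simp [insertBelow, insertRoot]
  | node _ l r ihl ihr =>
    simp only [insertBelow, insertRoot, (ihl _).1, (ihr _).1, (ihl _).2, (ihr _).2]
    constructor <;> ring

theorem insertLeaf_mul (t : BinaryTree Unit) (c : ℝ) (F : BinaryTree Unit → ℝ) :
    insertLeaf t (fun g => c * F g) = c * insertLeaf t F := by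
  simp only [insertLeaf, (insertBelow_mul t c F).1, (insertBelow_mul t c F).2, mul_add]

theorem degProd_addLast (t : BinaryTree Unit) :
    rootDeg (addLast t) = rootDeg t + 1 ∧
      degProd (addLast t) = (rootDeg t + 1) * degProd t := by
  induction t with
  | nil => simp [addLast, degProd, rootDeg]
  | node _ l r _ ih =>
    simp only [addLast, degProd, rootDeg, ih.1, ih.2, true_and]
    push_cast
    ring

/-- A further child of a vertex with `k` children multiplies the degree product by `k + 1`, which is
also the number of gaps where it could have been inserted. -/
theorem Symm.addLast_degProd {F : BinaryTree Unit → ℝ} (hF : Symm F) (t : BinaryTree Unit) :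
    degProd (addLast t) * F (addLast t) = degProd t * insertRoot t F := by
  rw [(degProd_addLast t).2, hF.addLast_eq, hF.insertRoot_eq]
  ring

theorem Symm.growBelow_degProd {F : BinaryTree Unit → ℝ} (hF : Symm F) (t : BinaryTree Unit) :
    growBelow t (fun g => degProd g * F g) = degProd t * insertBelow t F := by
  induction t generalizing F with
  | nil => simp [growBelow, insertBelow]
  | node _ l r ihl ihr =>
    simp only [growBelow, insertBelow, degProd]
    have h1 := ihl (hF.nodeLeft r)
    have h2 := (hF.nodeLeft r).addLast_degProd l
    have h3 := ihr (hF.nodeRight l)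
    have e1 : (fun g => ((rootDeg r : ℝ) + 1) * degProd g * degProd r * F (node () g r)) =
        fun g => ((rootDeg r : ℝ) + 1) * degProd r * (degProd g * F (node () g r)) := by
      funext g; ring
    have e2 := growBelow_rootDeg r
      fun n g => ((n : ℝ) + 1) * degProd l * degProd g * F (node () l g)
    have e3 : (fun g => ((rootDeg r : ℝ) + 1) * degProd l * degProd g * F (node () l g)) =
        fun g => ((rootDeg r : ℝ) + 1) * degProd l * (degProd g * F (node () l g)) := by
      funext g; ring
    rw [e1, e2, e3, growBelow_mul, growBelow_mul, h1, h3]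
    linear_combination ((rootDeg r : ℝ) + 1) * degProd r * h2

/-- With the weight `degProd`, adding last children amounts to inserting a leaf at every possible
place. -/
theorem Symm.grow_degProd {F : BinaryTree Unit → ℝ} (hF : Symm F) (t : BinaryTree Unit) :
    grow t (fun g => degProd g * F g) = degProd t * insertLeaf t F := by
  rw [grow, insertLeaf, hF.growBelow_degProd, hF.addLast_degProd, mul_add]

/-! ### The hook weight -/

theorem hook_pos (t : BinaryTree Unit) : 0 < hook t := by
  induction t with
  | nil => simp [hook]
  | node _ l r ihl ihr => rw [hook]; positivity

/-- Every term of the sum has exactly one node more than `t`, so a size-dependent factor becomes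
constant. -/
theorem insertRoot_numNodes (t : BinaryTree Unit) (F : ℕ → BinaryTree Unit → ℝ) :
    insertRoot t (fun g => F g.numNodes g) = insertRoot t (F (t.numNodes + 1)) := by
  induction t generalizing F with
  | nil => rfl
  | node _ l r ihl ihr =>
    simp only [insertRoot, numNodes]
    rw [ihr fun n g => F (l.numNodes + n + 1) (node () l g)]
    simp only [zero_add, ← add_assoc]

theorem insertBelow_numNodes (t : BinaryTree Unit) (F : ℕ → BinaryTree Unit → ℝ) :
    insertBelow t (fun g => F g.numNodes g) = insertBelow t (F (t.numNodes + 1)) := by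
  induction t generalizing F with
  | nil => rfl
  | node _ l r ihl ihr =>
    simp only [insertBelow, numNodes]
    rw [ihr fun n g => F (l.numNodes + n + 1) (node () l g),
      ihl fun n g => F (n + r.numNodes + 1) (node () g r),
      insertRoot_numNodes l fun n g => F (n + r.numNodes + 1) (node () g r)]
    rw [add_right_comm l.numNodes 1, ← add_assoc]

theorem insertLeaf_numNodes (t : BinaryTree Unit) (F : ℕ → BinaryTree Unit → ℝ) :
    insertLeaf t (fun g => F g.numNodes g) = insertLeaf t (F (t.numNodes + 1)) := by
  rw [insertLeaf, insertLeaf, insertBelow_numNodes, insertRoot_numNodes]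

theorem insertLeaf_node (l r : BinaryTree Unit) (F : BinaryTree Unit → ℝ) :
    insertLeaf (node () l r) F = insertLeaf l (fun g => F (node () g r)) +
      insertLeaf r (fun g => F (node () l g)) + F (node () nil (node () l r)) := by
  simp only [insertLeaf, insertBelow, insertRoot]
  ring

/-- The leaf goes into the first subtree, into the rest, or becomes the new first child. Only the
first case changes the factor `l.numNodes + 1`, and the new leaf itself has hook factor `1`. -/
theorem insertLeaf_hook_node (l r : BinaryTree Unit) (F : BinaryTree Unit → ℝ) :
    (hook (node () l r))⁻¹ * insertLeaf (node () l r) (fun g => hook g * F g) =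
      (l.numNodes + 2) / (l.numNodes + 1) *
        ((hook l)⁻¹ * insertLeaf l fun g => hook g * F (node () g r)) +
      (hook r)⁻¹ * insertLeaf r (fun g => hook g * F (node () l g)) +
      F (node () nil (node () l r)) := by
  have hl := (hook_pos l).ne'
  have hr := (hook_pos r).ne'
  rw [insertLeaf_node]
  simp only [hook]
  have e1 := insertLeaf_numNodes l fun n g => ((n : ℝ) + 1) * hook g * hook r * F (node () g r)
  have e2 : (fun g => (((l.numNodes + 1 : ℕ) : ℝ) + 1) * hook g * hook r * F (node () g r)) =
      fun g => ((l.numNodes : ℝ) + 2) * hook r * (hook g * F (node () g r)) := by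
    funext g; push_cast; ring
  have e3 : (fun g => ((l.numNodes : ℝ) + 1) * hook l * hook g * F (node () l g)) =
      fun g => ((l.numNodes : ℝ) + 1) * hook l * (hook g * F (node () l g)) := by
    funext g; ring
  rw [e1, e2, e3, insertLeaf_mul, insertLeaf_mul]
  simp only [numNodes]
  have : (l.numNodes : ℝ) + 1 ≠ 0 := by positivity
  field_simp
  ring

/-- A recursive form of the hook length formula for plane trees. -/
theorem treeSum_insertLeaf_hook (n : ℕ) (F : BinaryTree Unit → ℝ) :
    (treeSum n fun t => (hook t)⁻¹ * insertLeaf t fun g => hook g * F g) =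
      (n + 1) * treeSum (n + 1) F := by
  induction n using Nat.strong_induction_on generalizing F with
  | _ n ih =>
  rcases n with _ | n
  · simp [treeSum_zero, treeSum_succ, insertLeaf, insertBelow, insertRoot, hook]
  · have step : (treeSum (n + 1) fun t => (hook t)⁻¹ * insertLeaf t fun g => hook g * F g) =
        ∑ ij ∈ Finset.HasAntidiagonal.antidiagonal n, ((ij.1 + 2) *
          (treeSum (ij.1 + 1) fun l => treeSum ij.2 fun r => F (node () l r)) +
          (ij.2 + 1) * (treeSum ij.1 fun l => treeSum (ij.2 + 1) fun r => F (node () l r)) +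
          treeSum ij.1 fun l => treeSum ij.2 fun r => F (node () nil (node () l r))) := by
      rw [treeSum_succ]
      refine Finset.sum_congr rfl fun ij hij => ?_
      have hij := Finset.HasAntidiagonal.mem_antidiagonal.1 hij
      simp only [insertLeaf_hook_node]
      simp only [treeSum_add]
      congr 2
      · rw [treeSum_comm, treeSum_comm (ij.1 + 1), mul_treeSum]
        refine treeSum_congr fun r _ => ?_
        have h1 := ih ij.1 (by omega) fun l => F (node () l r)
        have hp : (ij.1 : ℝ) + 1 ≠ 0 := by positivity
        calc _ = treeSum ij.1 fun l => ((ij.1 : ℝ) + 2) / (ij.1 + 1) *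
              ((hook l)⁻¹ * insertLeaf l fun g => hook g * F (node () g r)) :=
            treeSum_congr fun l hl => by rw [hl]
          _ = _ := by rw [← mul_treeSum, h1]; field_simp
      · rw [mul_treeSum]
        exact treeSum_congr fun l _ => ih ij.2 (by omega) fun r => F (node () l r)
    rw [step, treeSum_succ (n + 1)]
    -- The factor `n + 2` is split as `(i + 1) + j` over `i + j = n + 1`. The parts `i + 1` with `i
    -- ≥ 1` match insertions into the first subtree, `i = 0` matches the new first child, and the
    -- parts `j` match insertions into the rest.
    have hc : ∀ (i j : ℕ), i + j = n + 1 → ∀ x : ℝ, ((n + 1 : ℕ) + 1 : ℝ) * x =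
        (i + 1) * x + j * x := by
      intro i j h x
      rw [← h]; push_cast; ring
    rw [Finset.mul_sum, Finset.sum_congr rfl fun ij hij =>
      hc ij.1 ij.2 (Finset.HasAntidiagonal.mem_antidiagonal.1 hij) _]
    simp only [Finset.sum_add_distrib]
    rw [Finset.Nat.sum_antidiagonal_succ, Finset.Nat.sum_antidiagonal_succ']
    simp only [treeSum_zero]
    rw [treeSum_succ n fun r => F (node () nil r)]
    push_cast
    simp only [add_assoc, one_add_one_eq_two]
    ring

/-! ### Tree factorial, elementary differential and iterated integrals on binary trees -/

/-- The binary tree that stands for a plane tree. -/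
def PlaneTree.toBinary : PlaneTree → BinaryTree Unit
  | .node [] => nil
  | .node (t :: ts) => BinaryTree.node () t.toBinary (PlaneTree.node ts).toBinary

theorem PlaneTree.toBinary_node (ts : List PlaneTree) :
    (PlaneTree.node ts).toBinary =
      ts.foldr (fun t r => BinaryTree.node () t.toBinary r) nil := by
  induction ts with
  | nil => rw [PlaneTree.toBinary]; rfl
  | cons t ts ih => rw [PlaneTree.toBinary, ih]; rfl

/-- The plane tree that a binary tree stands for. -/
def PlaneTree.ofBinary : BinaryTree Unit → PlaneTree
  | nil => .node []
  | .node _ l r => match PlaneTree.ofBinary r with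
    | .node ts => .node (PlaneTree.ofBinary l :: ts)

theorem PlaneTree.ofBinary_toBinary (t : PlaneTree) : PlaneTree.ofBinary t.toBinary = t := by
  induction t using PlaneTree.toBinary.induct with
  | case1 => rw [PlaneTree.toBinary, PlaneTree.ofBinary]
  | case2 t ts h1 h2 => rw [PlaneTree.toBinary, PlaneTree.ofBinary, h1, h2]

theorem PlaneTree.size_eq (t : PlaneTree) : t.size = t.toBinary.numNodes + 1 := by
  induction t using PlaneTree.toBinary.induct with
  | case1 => simp [PlaneTree.size, PlaneTree.toBinary]
  | case2 t ts h1 h2 =>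
    simp only [PlaneTree.size, PlaneTree.toBinary, numNodes, List.map_cons, List.sum_cons] at *
    omega

/-- `hook` omits the factor of the root, which is supplied here by `numNodes + 1`. -/
theorem PlaneTree.factorial_eq (t : PlaneTree) :
    (t.factorial : ℝ) = (t.toBinary.numNodes + 1) * hook t.toBinary := by
  have key : ∀ ts : List PlaneTree, (PlaneTree.node ts).factorial =
      (PlaneTree.node ts).size * (ts.map fun t => t.factorial).prod := fun ts => by
    rw [PlaneTree.factorial]
  suffices h : ∀ ts : List PlaneTree, (((ts.map fun t => t.factorial).prod : ℕ) : ℝ) =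
      hook (PlaneTree.node ts).toBinary by
    obtain ⟨ts⟩ := t
    rw [key, Nat.cast_mul, h, PlaneTree.size_eq]
    push_cast
    rfl
  suffices h : ∀ t : PlaneTree, ∀ ts, t = .node ts →
      (((ts.map fun t => t.factorial).prod : ℕ) : ℝ) = hook t.toBinary from
    fun ts => h _ ts rfl
  intro t
  induction t using PlaneTree.toBinary.induct with
  | case1 =>
    rintro ts h
    cases h
    simp [PlaneTree.toBinary, hook]
  | case2 t ts h1 h2 =>
    rintro ts' h
    cases h
    obtain ⟨us⟩ := t
    rw [PlaneTree.toBinary, hook, ← h2 ts rfl, ← h1 us rfl, List.map_cons, List.prod_cons, key,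
      PlaneTree.size_eq]
    push_cast
    rfl

theorem coeff_inv_one_sub_X (n : ℕ) :
    PowerSeries.coeff n ((1 - PowerSeries.X : PowerSeries ℝ)⁻¹) = 1 := by
  have h : (PowerSeries.mk 1 : PowerSeries ℝ) = (1 - PowerSeries.X)⁻¹ := by
    rw [PowerSeries.eq_inv_iff_mul_eq_one (by simp)]
    exact PowerSeries.mk_one_mul_one_sub_eq_one ℝ
  rw [← h]
  simp

theorem PlaneTree.elemDiff_eq (t : PlaneTree) :
    t.elemDiff (1 - PowerSeries.X)⁻¹ = degProd t.toBinary := by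
  have key : ∀ ts : List PlaneTree, (PlaneTree.node ts).elemDiff (1 - PowerSeries.X)⁻¹ =
      (ts.length.factorial : ℝ) * (ts.map fun t => t.elemDiff (1 - PowerSeries.X)⁻¹).prod :=
    fun ts => by rw [PlaneTree.elemDiff, coeff_inv_one_sub_X, mul_one]
  have hdeg : ∀ ts : List PlaneTree, rootDeg (PlaneTree.node ts).toBinary = ts.length := by
    intro ts
    induction ts with
    | nil => simp [PlaneTree.toBinary, rootDeg]
    | cons t ts ih => simp [PlaneTree.toBinary, rootDeg, ih]
  induction t using PlaneTree.toBinary.induct with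
  | case1 => simp [key, PlaneTree.toBinary, degProd]
  | case2 t ts h1 h2 =>
    rw [PlaneTree.toBinary, degProd, ← h2, ← h1, key, key, hdeg, List.map_cons, List.prod_cons,
      List.length_cons, Nat.factorial_succ]
    push_cast
    ring

/-- The iterated integrals in terms of binary trees. -/
noncomputable def binaryIter : BinaryTree Unit → (ℝ → ℝ → ℝ) → (ℝ → ℝ → ℝ) → ℝ → ℝ
  | nil, _, _, _ => 1
  | node _ l r, a, a', u =>
    (∫ v in (0 : ℝ)..1, a u v * binaryIter l a' a v) * binaryIter r a a' u

theorem PlaneTree.iter_eq (t : PlaneTree) : t.iter = binaryIter t.toBinary := by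
  induction t using PlaneTree.toBinary.induct with
  | case1 => funext a a' u; simp [PlaneTree.iter, PlaneTree.toBinary, binaryIter]
  | case2 t ts h1 h2 =>
    funext a a' u
    rw [PlaneTree.toBinary, binaryIter, ← h2, ← h1]
    simp [PlaneTree.iter]

theorem symm_binaryIter (a a' : ℝ → ℝ → ℝ) (u : ℝ) : Symm fun t => binaryIter t a a' u := by
  intro s t h
  induction h generalizing a a' u with
  | swap => simp only [binaryIter]; ring
  | left c _ ih => simp only [binaryIter, ih]
  | right c _ ih => simp only [binaryIter, ih]

theorem growBelow_const_zero (t : BinaryTree Unit) : growBelow t (fun _ => 0) = 0 := by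
  simpa using growBelow_mul t 0 fun _ => 0

theorem numNodes_addLast (t : BinaryTree Unit) : (addLast t).numNodes = t.numNodes + 1 := by
  induction t with
  | nil => rfl
  | node _ l r _ ih => rw [addLast, numNodes, ih, numNodes]; omega

theorem grow_numNodes (t : BinaryTree Unit) (F : ℕ → BinaryTree Unit → ℝ) :
    grow t (fun g => F g.numNodes g) = grow t (F (t.numNodes + 1)) := by
  rw [grow, grow, numNodes_addLast, add_left_inj]
  induction t generalizing F with
  | nil => rfl
  | node _ l r ihl ihr =>
    simp only [growBelow, numNodes, numNodes_addLast]
    rw [ihr fun n g => F (l.numNodes + n + 1) (.node () l g),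
      ihl fun n g => F (n + r.numNodes + 1) (.node () g r)]
    rw [add_right_comm l.numNodes 1, ← add_assoc]

/-! ### Growth of labelled trees -/

namespace LTree

variable {m : ℕ}

/-- The subtree at vertex `i`, as a binary tree. -/
def binary (p : LTree m) (i : ℕ) : BinaryTree Unit := (p.subtree i).toBinary

/-- The children of the vertex `i`. -/
def children (p : LTree m) (i : ℕ) : List ℕ :=
  ((List.finRange m).filter fun j => (p j).val = i).map fun j => j.val + 1

/-- The tree consisting of a root with the subtrees of `p` at the vertices in `l` attached. -/
def attach (p : LTree m) (l : List ℕ) : BinaryTree Unit :=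
  l.foldr (fun c r => BinaryTree.node () (p.binary c) r) nil

theorem binary_eq (p : LTree m) (i : ℕ) : p.binary i = p.attach (p.children i) := by
  rw [binary, subtree, PlaneTree.toBinary_node, attach, children, List.foldr_map, List.foldr_map]
  exact List.foldr_attach (l := (List.finRange m).filter fun j => (p j).val = i)
    (f := fun j r => BinaryTree.node () (p.subtree (j.val + 1)).toBinary r)

theorem mem_children {p : LTree m} {i c : ℕ} :
    c ∈ p.children i ↔ ∃ j : Fin m, (p j).val = i ∧ j.val + 1 = c := by
  simp [children]

theorem nodup_children (p : LTree m) (i : ℕ) : (p.children i).Nodup :=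
  ((List.nodup_finRange m).filter _).map fun _ _ h => Fin.ext (Nat.succ_injective h)

/-- Adds the new vertex `m + 1` as a child of `v`. -/
def snoc (p : LTree m) (v : Fin (m + 1)) : LTree (m + 1) :=
  Fin.snoc (α := fun j : Fin (m + 1) => Fin (j.val + 1)) p v

theorem sum_snoc (f : LTree (m + 1) → ℝ) : ∑ q, f q = ∑ p : LTree m, ∑ v, f (p.snoc v) := by
  rw [← (Fin.snocEquiv fun j : Fin (m + 1) => Fin (j.val + 1)).sum_comp f,
    Fintype.sum_prod_type, Finset.sum_comm]
  rfl

/-- The new vertex has the largest label, hence comes last in the list of children. This is why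
growth of labelled trees is modelled by `addLast`. -/
theorem children_snoc (p : LTree m) (v : Fin (m + 1)) (i : ℕ) :
    (p.snoc v).children i = p.children i ++ if v.val = i then [m + 1] else [] := by
  have h1 : ∀ j : Fin m, p.snoc v j.castSucc = p j := fun j => Fin.snoc_castSucc ..
  have h2 : p.snoc v (Fin.last m) = v := Fin.snoc_last ..
  rw [children, children, List.finRange_succ_last, List.filter_append, List.map_append,
    List.filter_map, List.map_map]
  congr 1
  · simp only [Function.comp_def, h1]
    rfl
  · rw [List.filter_singleton, h2]
    by_cases h : v.val = i <;> simp [h]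

/-- `p.Desc v i`: the vertex `v` belongs to the subtree at the vertex `i`. -/
inductive Desc (p : LTree m) : ℕ → ℕ → Prop
  | refl (i : ℕ) : Desc p i i
  | step {i : ℕ} (j : Fin m) : Desc p (p j) i → Desc p (j + 1) i

theorem Desc.le {p : LTree m} {v i : ℕ} (h : p.Desc v i) : i ≤ v := by
  induction h with
  | refl => rfl
  | step j _ ih => have := (p j).isLt; omega

theorem Desc.cases_top {p : LTree m} {v i : ℕ} (h : p.Desc v i) :
    v = i ∨ ∃ c ∈ p.children i, p.Desc v c := by
  induction h with
  | refl => exact .inl rfl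
  | @step i j h ih =>
    rcases ih with h' | ⟨c, hc, h'⟩
    · exact .inr ⟨j + 1, mem_children.2 ⟨j, h', rfl⟩, .refl _⟩
    · exact .inr ⟨c, hc, .step j h'⟩

theorem Desc.of_child {p : LTree m} {v i c : ℕ} (h : p.Desc v c) (hc : c ∈ p.children i) :
    p.Desc v i := by
  induction h with
  | refl =>
    obtain ⟨j, rfl, rfl⟩ := mem_children.1 hc
    exact .step j (.refl _)
  | step j _ ih => exact .step j (ih hc)

theorem lt_of_mem_children {p : LTree m} {i c : ℕ} (hc : c ∈ p.children i) : i < c ∧ c ≤ m := by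
  obtain ⟨j, rfl, rfl⟩ := mem_children.1 hc
  have := (p j).isLt
  omega

theorem Desc.cases_bot {p : LTree m} {v i : ℕ} (h : p.Desc v i) :
    v = i ∨ ∃ j : Fin m, v = j + 1 ∧ p.Desc (p j) i := by
  cases h with
  | refl => exact .inl rfl
  | step j h => exact .inr ⟨j, rfl, h⟩

/-- Subtrees at distinct siblings are disjoint: if `c` lay properly below its sibling `d`, so would
their common parent, whose label is smaller than `d`. A new vertex thus enters the subtree of at
most one child. -/
theorem Desc.child_unique {p : LTree m} {v i c d : ℕ} (hc : c ∈ p.children i)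
    (hd : d ∈ p.children i) (h : p.Desc v c) (h' : p.Desc v d) : c = d := by
  have key : ∀ {c d : ℕ}, c ∈ p.children i → d ∈ p.children i → p.Desc c d → c = d := by
    intro c d hc hd h
    rcases h.cases_bot with h | ⟨j, rfl, hj⟩
    · exact h
    · obtain ⟨j', rfl, hj'⟩ := mem_children.1 hc
      obtain rfl : j = j' := Fin.ext (by omega)
      exact absurd hj.le (not_le.2 (lt_of_mem_children hd).1)
  induction h with
  | refl => exact key hc hd h'
  | step j h ih =>
    rcases h'.cases_bot with h' | ⟨j', hj, h'⟩
    · subst h'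
      exact (key hd hc (.step j h)).symm
    · obtain rfl : j = j' := Fin.ext (by omega)
      exact ih hc h'

theorem desc_zero (p : LTree m) {v : ℕ} (hv : v ≤ m) : p.Desc v 0 := by
  induction v using Nat.strong_induction_on with
  | _ v ih =>
  rcases v with _ | v
  · exact .refl 0
  · exact .step ⟨v, hv⟩ (ih _ (p ⟨v, hv⟩).isLt (by have := (p ⟨v, hv⟩).isLt; simp only at this; omega))

theorem binary_snoc_last (p : LTree m) (v : Fin (m + 1)) : (p.snoc v).binary (m + 1) = nil := by
  have h : p.children (m + 1) = [] := List.eq_nil_iff_forall_not_mem.2 fun c hc => by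
    have := lt_of_mem_children hc
    omega
  rw [binary_eq, children_snoc, if_neg (by omega), List.append_nil, h]
  rfl

theorem attach_congr {m' : ℕ} {p : LTree m} {q : LTree m'} {l : List ℕ}
    (h : ∀ c ∈ l, p.binary c = q.binary c) : p.attach l = q.attach l := by
  induction l with
  | nil => rfl
  | cons c l ih =>
    simp only [List.mem_cons, forall_eq_or_imp] at h
    simp only [attach, List.foldr_cons, h.1] at ih ⊢
    rw [ih h.2]

/-- The new leaf is visible only from the ancestors of its parent `v`. Labels increase away from the
root, so `m - i` serves as the induction measure. -/
theorem binary_snoc_of_not_desc (p : LTree m) (v : Fin (m + 1)) (i : ℕ) (h : ¬ p.Desc v i) :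
    (p.snoc v).binary i = p.binary i := by
  induction hk : m - i using Nat.strong_induction_on generalizing i with
  | _ k ih =>
  have hv : v.val ≠ i := fun hv => h (hv ▸ .refl _)
  rw [binary_eq, binary_eq, children_snoc, if_neg hv, List.append_nil]
  refine attach_congr fun c hc => ih (m - c) ?_ c (fun hd => h (hd.of_child hc)) rfl
  have := lt_of_mem_children hc
  omega

theorem attach_append (p : LTree m) (l : List ℕ) (c : ℕ) (hc : p.binary c = nil) :
    p.attach (l ++ [c]) = addLast (p.attach l) := by
  induction l with
  | nil => simp [attach, addLast, hc]
  | cons d l ih => simpa [attach, addLast] using ih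

open Classical in
theorem sum_growBelow (p : LTree m) (l : List ℕ) (hl : l.Nodup)
    (hu : ∀ c ∈ l, ∀ d ∈ l, ∀ v, p.Desc v c → p.Desc v d → c = d)
    (ih : ∀ c ∈ l, ∀ F : BinaryTree Unit → ℝ,
      (∑ v : Fin (m + 1), if p.Desc v c then F ((p.snoc v).binary c) else 0) =
        grow (p.binary c) F) (F : BinaryTree Unit → ℝ) :
    (∑ v : Fin (m + 1), if ∃ c ∈ l, p.Desc v c then F ((p.snoc v).attach l) else 0) =
      growBelow (p.attach l) F := by
  induction l generalizing F with
  | nil => simp [attach, growBelow]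
  | cons c l ihl =>
    have hl' := List.nodup_cons.1 hl
    have ihl := ihl hl'.2 (fun c hc d hd => hu c (by simp [hc]) d (by simp [hd]))
      (fun c hc => ih c (by simp [hc])) fun g => F (.node () (p.binary c) g)
    have ihc := ih c (by simp) fun g => F (.node () g (p.attach l))
    have hcons : ∀ {m : ℕ} (p : LTree m), p.attach (c :: l) = .node () (p.binary c) (p.attach l) :=
      fun p => rfl
    rw [hcons, growBelow]
    rw [grow] at ihc
    rw [← ihc, ← ihl, ← Finset.sum_add_distrib]
    refine Finset.sum_congr rfl fun v _ => ?_
    by_cases h1 : p.Desc v c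
    · have h2 : ∀ d ∈ l, ¬ p.Desc v d := fun d hd h2 =>
        hl'.1 (hu c (by simp) d (by simp [hd]) v h1 h2 ▸ hd)
      have h3 : ¬ ∃ d ∈ l, p.Desc v d := fun ⟨d, hd, h⟩ => h2 d hd h
      rw [if_pos ⟨c, by simp, h1⟩, if_pos h1, if_neg h3, add_zero, hcons,
        attach_congr fun d hd => binary_snoc_of_not_desc p v d (h2 d hd)]
    · rw [if_neg h1, zero_add, hcons, binary_snoc_of_not_desc p v c h1]
      simp [h1]

open Classical in
-- A vertex `v` of the subtree at `i` is either `i` itself, which gives the `addLast` term, or lies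
-- below exactly one child of `i`, which gives the `growBelow` terms.
theorem sum_grow (p : LTree m) (i : ℕ) (hi : i ≤ m) (F : BinaryTree Unit → ℝ) :
    (∑ v : Fin (m + 1), if p.Desc v i then F ((p.snoc v).binary i) else 0) =
      grow (p.binary i) F := by
  induction hk : m - i using Nat.strong_induction_on generalizing i F with
  | _ k ih =>
  have hb := sum_growBelow p (p.children i) (p.nodup_children i)
    (fun c hc d hd v h h' => h.child_unique hc hd h')
    (fun c hc F => ih (m - c) (by have := lt_of_mem_children hc; omega) c
      (lt_of_mem_children hc).2 F rfl) F
  have hlast : addLast (p.binary i) = (p.snoc ⟨i, by omega⟩).binary i := by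
    rw [binary_eq, binary_eq, children_snoc, if_pos rfl, attach_append _ _ _ (binary_snoc_last _ _)]
    congr 1
    refine (attach_congr fun c hc => binary_snoc_of_not_desc p _ c fun hd => ?_).symm
    exact absurd hd.le (not_le.2 (lt_of_mem_children hc).1)
  rw [grow, hlast, binary_eq p i, ← hb]
  have h0 : F ((p.snoc ⟨i, by omega⟩).binary i) =
      ∑ v : Fin (m + 1), if v = ⟨i, by omega⟩ then F ((p.snoc v).binary i) else 0 := by
    rw [Finset.sum_ite_eq' Finset.univ (⟨i, by omega⟩ : Fin (m + 1))]
    simp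
  rw [h0, ← Finset.sum_add_distrib]
  refine Finset.sum_congr rfl fun v _ => ?_
  by_cases hv : v.val = i
  · have h1 : p.Desc v i := hv ▸ .refl _
    have h2 : ¬ ∃ c ∈ p.children i, p.Desc v c := fun ⟨c, hc, h⟩ => by
      have := h.le
      have := (lt_of_mem_children hc).1
      omega
    rw [if_pos h1, if_neg h2, if_pos (Fin.ext hv), zero_add]
  · have h1 : p.Desc v i ↔ ∃ c ∈ p.children i, p.Desc v c :=
      ⟨fun h => h.cases_top.resolve_left hv, fun ⟨c, hc, h⟩ => h.of_child hc⟩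
    have h2 : ¬ v = (⟨i, by omega⟩ : Fin (m + 1)) := fun h => hv (congrArg Fin.val h)
    rw [if_neg h2, add_zero, binary_eq, children_snoc, if_neg hv, List.append_nil]
    simp only [h1]

/-- The labelled trees with a further vertex are obtained by adding a last child to some vertex. -/
theorem sum_binary_snoc (p : LTree m) (F : BinaryTree Unit → ℝ) :
    ∑ v, F ((p.snoc v).binary 0) = grow (p.binary 0) F := by
  rw [← sum_grow p 0 (Nat.zero_le m)]
  exact Finset.sum_congr rfl fun v _ => (if_pos (p.desc_zero (Nat.lt_succ_iff.1 v.isLt))).symm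

/-- Weighted by tree factorials and products of factorials of degrees, the labelled trees are
equidistributed on the plane trees. -/
theorem sum_binary (m : ℕ) {F : BinaryTree Unit → ℝ} (hF : Symm F) :
    ∑ p : LTree m, degProd (p.binary 0) * (hook (p.binary 0) * F (p.binary 0)) =
      m.factorial * treeSum m F := by
  induction m generalizing F with
  | zero =>
    have : ∀ p : LTree 0, p.binary 0 = nil := fun p => by rw [binary_eq]; rfl
    simp [this, treeSum_zero, degProd, hook]
  | succ m ih =>
    rw [sum_snoc]
    -- The inverse hook cancels the weight `hook` in the induction hypothesis and leaves the leaf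
    -- insertions produced by `grow`; on the plane-tree side `treeSum_insertLeaf_hook` then supplies
    -- the factor `m + 1`.
    have h := ih (F := fun t => (hook t)⁻¹ * insertLeaf t fun g => hook g * F g)
      (fun s t hs => by
        simp only [symm_hook hs, symm_insertLeaf (symm_hook.mul hF) hs])
    rw [treeSum_insertLeaf_hook] at h
    rw [Nat.factorial_succ]
    push_cast
    rw [mul_comm ((m : ℝ) + 1), mul_assoc, ← h]
    refine Finset.sum_congr rfl fun p _ => ?_
    rw [p.sum_binary_snoc fun t => degProd t * (hook t * F t),
      (symm_hook.mul hF).grow_degProd, mul_inv_cancel_left₀ (hook_pos _).ne']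

theorem numNodes_binary (p : LTree m) : (p.binary 0).numNodes = m := by
  induction m with
  | zero => rw [binary_eq]; rfl
  | succ m ih =>
    -- `F` indicates a wrong node count. Its sum over all one-vertex extensions vanishes, so each
    -- nonnegative term does.
    let F : BinaryTree Unit → ℝ := fun g => if g.numNodes = m + 1 then 0 else 1
    have h : ∑ v, F ((snoc (m := m) (Fin.init p) v).binary 0) = 0 := by
      rw [sum_binary_snoc, grow_numNodes _ fun n _ => if n = m + 1 then 0 else 1, ih]
      simp [grow, growBelow_const_zero]
    rw [Finset.sum_eq_zero_iff_of_nonneg fun v _ => by simp only [F]; split_ifs <;> simp] at h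
    have h := h (p (Fin.last m)) (Finset.mem_univ _)
    rw [show snoc (m := m) (Fin.init p) (p (Fin.last m)) = p from Fin.snoc_init_self p] at h
    by_contra hne
    simp [F, hne] at h

end LTree

/-! ### From rooted trees to sums over plane trees -/

theorem RTree.size_mk (t : PlaneTree) : RTree.size (Quot.mk _ t) = t.size := rfl

/-- A `finsum` with infinite support has the default value `0`; finiteness makes the coefficients of
`seriesY` genuine sums. -/
theorem finite_setOf_size_eq (n : ℕ) : {t : RTree | t.size = n}.Finite := by
  refine ((BinaryTree.treesOfNumNodesEq (n - 1)).finite_toSet.image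
    fun b : BinaryTree Unit => (Quot.mk _ (PlaneTree.ofBinary b) : RTree)).subset ?_
  rintro ⟨t⟩ ht
  refine ⟨t.toBinary, ?_, ?_⟩
  · have : t.toBinary.numNodes + 1 = n := by rw [← t.size_eq]; exact ht
    simp only [Finset.mem_coe, mem_treesOfNumNodesEq]
    omega
  · simp only [PlaneTree.ofBinary_toBinary]

theorem RTree.size_pos (t : RTree) : 0 < t.size := by
  obtain ⟨t⟩ := t
  rw [RTree.size_mk, t.size_eq]
  omega

theorem size_shape {m : ℕ} (p : LTree m) : p.shape.size = m + 1 := by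
  rw [LTree.shape, RTree.size_mk, PlaneTree.size_eq]
  exact congrArg (· + 1) p.numNodes_binary

/-- Sums over rooted trees weighted by the numbers `α(t)` are sums over labelled trees. -/
theorem finsum_alpha (m : ℕ) (f : RTree → ℝ) :
    ∑ᶠ (t : RTree) (_ : t.size = m + 1), t.alpha * f t = ∑ p : LTree m, f p.shape := by
  classical
  have hfin := finite_setOf_size_eq (m + 1)
  have h1 : ∑ᶠ (t : RTree) (_ : t.size = m + 1), t.alpha * f t =
      ∑ t ∈ hfin.toFinset, t.alpha * f t :=
    finsum_mem_eq_finite_toFinset_sum (fun t => t.alpha * f t) hfin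
  rw [h1, ← Finset.sum_fiberwise_of_maps_to (s := Finset.univ) (t := hfin.toFinset)
    (g := fun p : LTree m => p.shape) (fun p _ => by simp [size_shape])]
  refine Finset.sum_congr rfl fun t ht => ?_
  have ht : t.size = m + 1 := by simpa using ht
  have hα : t.alpha = (Finset.univ.filter fun p : LTree m => p.shape = t).card := by
    rw [RTree.alpha, ht, Nat.add_sub_cancel, Nat.card_eq_fintype_card, Fintype.card_subtype]
  rw [hα, Finset.sum_congr rfl (g := fun _ => f t) fun p hp => by rw [(Finset.mem_filter.1 hp).2],
    Finset.sum_const, nsmul_eq_mul]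

/-- The coefficients of `seriesY` as sums over plane trees. -/
theorem coeff_seriesY (ax ay : ℝ → ℝ → ℝ) (u : ℝ) (m : ℕ) :
    PowerSeries.coeff (m + 1) (seriesY (1 - PowerSeries.X)⁻¹ ax ay u) =
      treeSum m fun t => ∫ v in (0 : ℝ)..1, ay u v * binaryIter t ax ay v := by
  have hS : Symm fun t => ∫ v in (0 : ℝ)..1, ay u v * binaryIter t ax ay v := by
    intro s t h
    simp only [symm_binaryIter ax ay _ h]
  rw [seriesY, PowerSeries.coeff_mk]
  simp only [mul_assoc, mul_left_comm (1 / ((m + 1).factorial : ℝ)) (RTree.alpha _ : ℝ)]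
  rw [finsum_alpha m fun t => 1 / ((m + 1).factorial : ℝ) * ((t.factorial : ℝ) *
    (t.elemDiff (1 - PowerSeries.X)⁻¹ * ∫ v in (0 : ℝ)..1, ay u v * t.phiX ax ay v)),
    ← mul_right_inj' (Nat.cast_ne_zero.2 m.factorial_ne_zero : (m.factorial : ℝ) ≠ 0),
    ← LTree.sum_binary m hS, Finset.mul_sum]
  refine Finset.sum_congr rfl fun p _ => ?_
  -- The root contributes `m + 1` to the tree factorial, which reduces `1/(m+1)!` to `1/m!` and so
  -- cancels the factor from `LTree.sum_binary`.
  have h1 : (p.shape.factorial : ℝ) = (m + 1) * hook (p.binary 0) := by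
    have := (p.subtree 0).factorial_eq
    rw [show (p.subtree 0).toBinary = p.binary 0 from rfl, p.numNodes_binary] at this
    exact this
  have h2 : p.shape.elemDiff (1 - PowerSeries.X)⁻¹ = degProd (p.binary 0) :=
    (p.subtree 0).elemDiff_eq
  have h3 : ∀ v, p.shape.phiX ax ay v = binaryIter (p.binary 0) ax ay v := fun v =>
    congrFun (congrFun (congrFun (p.subtree 0).iter_eq ax) ay) v
  rw [h1, h2, Nat.factorial_succ]
  simp only [h3]
  have : (m.factorial : ℝ) ≠ 0 := Nat.cast_ne_zero.2 m.factorial_ne_zero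
  push_cast
  field_simp

theorem coeff_zero_seriesY (ψ : PowerSeries ℝ) (ax ay : ℝ → ℝ → ℝ) (u : ℝ) :
    PowerSeries.coeff 0 (seriesY ψ ax ay u) = 0 := by
  rw [seriesY, PowerSeries.coeff_mk]
  simp [fun t : RTree => t.size_pos.ne']

end DykemaHaagerup

namespace DykemaHaagerup

open Polynomial

/-! ### The coupled differential equations over formal power series -/

section CoupledSystem

variable {K : Type*} [Field K]

theorem eq_of_derivative_eq [CharZero K] {p q : K[X]} (z : K) (h : derivative p = derivative q)
    (hz : p.eval z = q.eval z) : p = q := by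
  rw [← sub_eq_zero, ← derivative_sub] at h
  have := eq_C_of_natDegree_eq_zero (derivative_eq_zero.1 h)
  rw [← sub_eq_zero, ← eval_sub, this, eval_C] at hz
  rw [← sub_eq_zero, this, hz, C_0]

/-- The derivative with respect to the coefficient variable. -/
noncomputable def coeffDeriv (f : PowerSeries K[X]) : PowerSeries K[X] :=
  PowerSeries.mk fun n => derivative (PowerSeries.coeff n f)

@[simp]
theorem coeff_coeffDeriv (f : PowerSeries K[X]) (n : ℕ) :
    PowerSeries.coeff n (coeffDeriv f) = derivative (PowerSeries.coeff n f) :=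
  PowerSeries.coeff_mk _ _

theorem coeffDeriv_mul (f g : PowerSeries K[X]) :
    coeffDeriv (f * g) = coeffDeriv f * g + f * coeffDeriv g := by
  ext1 n
  simp only [coeff_coeffDeriv, map_add, PowerSeries.coeff_mul, derivative_sum, derivative_mul,
    Finset.sum_add_distrib]

theorem coeffDeriv_sub (f g : PowerSeries K[X]) :
    coeffDeriv (f - g) = coeffDeriv f - coeffDeriv g := by
  ext1 n
  simp

theorem coeffDeriv_map_C (w : PowerSeries K) : coeffDeriv (w.map C) = 0 := by
  ext1 n
  simp

theorem coeffDeriv_map_comp (f : PowerSeries K[X]) (z : K) :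
    coeffDeriv (f.map (compRingHom (X - C z))) = (coeffDeriv f).map (compRingHom (X - C z)) := by
  ext1 n
  simp [derivative_comp]

theorem map_evalRingHom_map_C (w : PowerSeries K) (z : K) :
    (w.map C).map (evalRingHom z) = w := by
  ext n
  simp

theorem eq_map_C_of_coeffDeriv_eq_zero [CharZero K] {f : PowerSeries K[X]} (h : coeffDeriv f = 0) (z : K) :
    f = (f.map (evalRingHom z)).map C := by
  ext1 n
  refine eq_of_derivative_eq z ?_ (by simp)
  have := congrArg (PowerSeries.coeff n) h
  simpa using this

/-- The linear differential equation `∂f = -w f` has at most one solution with a given value. -/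
theorem eq_zero_of_coeffDeriv_eq [CharZero K] {w : PowerSeries K} (hw : PowerSeries.constantCoeff w = 0)
    {f : PowerSeries K[X]} (hf : coeffDeriv f = -(w.map C * f)) (z : K)
    (hz : f.map (evalRingHom z) = 0) : f = 0 := by
  ext1 n
  induction n using Nat.strong_induction_on with
  | _ n ih =>
  refine eq_of_derivative_eq z ?_ (by simpa using congrArg (PowerSeries.coeff n) hz)
  have h := congrArg (PowerSeries.coeff n) hf
  rw [coeff_coeffDeriv, map_neg, PowerSeries.coeff_mul, Finset.sum_eq_zero] at h
  · simpa using h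
  · rintro ⟨i, j⟩ hij
    have hij := Finset.HasAntidiagonal.mem_antidiagonal.1 hij
    simp only at hij
    rcases Nat.eq_zero_or_pos i with rfl | hi
    · simp [hw]
    · rw [ih j (by omega)]
      simp

/-- A solution of `∂f = -w f` with value `1` at `0` is the exponential series. -/
theorem coeff_coeff_of_coeffDeriv_eq [CharZero K] {w : PowerSeries K} {f : PowerSeries K[X]}
    (hf : coeffDeriv f = -(w.map C * f)) (h0 : f.map (evalRingHom 0) = 1) (n k : ℕ) :
    (PowerSeries.coeff n f).coeff k =
      (-1) ^ k / (k.factorial : K) * PowerSeries.coeff n (w ^ k) := by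
  induction k generalizing n with
  | zero =>
    have := congrArg (PowerSeries.coeff n) h0
    rw [PowerSeries.coeff_map, coe_evalRingHom, ← coeff_zero_eq_eval_zero] at this
    simp [this]
  | succ k ih =>
    have h := congrArg (fun g => (PowerSeries.coeff n g).coeff k) hf
    simp only [coeff_coeffDeriv, coeff_derivative, map_neg, PowerSeries.coeff_mul, coeff_neg,
      finsetSum_coeff, PowerSeries.coeff_map, coeff_C_mul, ih] at h
    have hk : ((k : K) + 1) ≠ 0 := Nat.cast_add_one_ne_zero k
    rw [← mul_left_inj' hk, h, pow_succ' w, PowerSeries.coeff_mul, Nat.factorial_succ,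
      ← Finset.sum_neg_distrib, Finset.mul_sum, Finset.sum_mul]
    refine Finset.sum_congr rfl fun ij _ => ?_
    have : (k.factorial : K) ≠ 0 := Nat.cast_ne_zero.2 k.factorial_ne_zero
    push_cast
    field_simp
    ring

/-- The coefficients of the solution of `∂X = s / (1 - Y)`, `∂Y = -s / (1 - X)` with boundary
values `X(0) = 0`, `Y(1) = 0`: here `X = ∑ xₙ sⁿ⁺¹`, `Y = ∑ yₙ sⁿ⁺¹`, and `aₙ`, `bₙ` are the
coefficients of `1 / (1 - X)`, `1 / (1 - Y)`. -/
structure CoupledSystem (a b x y : ℕ → K[X]) : Prop where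
  a_zero : a 0 = 1
  b_zero : b 0 = 1
  a_succ : ∀ n, a (n + 1) = ∑ ij ∈ Finset.HasAntidiagonal.antidiagonal n, x ij.1 * a ij.2
  b_succ : ∀ n, b (n + 1) = ∑ ij ∈ Finset.HasAntidiagonal.antidiagonal n, y ij.1 * b ij.2
  derivative_x : ∀ n, derivative (x n) = b n
  derivative_y : ∀ n, derivative (y n) = -a n
  eval_x : ∀ n, (x n).eval 0 = 0
  eval_y : ∀ n, (y n).eval 1 = 0

namespace CoupledSystem

variable {a b x y : ℕ → K[X]}

theorem mk_mul_eq_one {R : Type*} [CommRing R] {a x : ℕ → R} (h0 : a 0 = 1)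
    (h : ∀ n, a (n + 1) = ∑ ij ∈ Finset.HasAntidiagonal.antidiagonal n, x ij.1 * a ij.2) :
    PowerSeries.mk a * (1 - PowerSeries.X * PowerSeries.mk x) = 1 := by
  have : PowerSeries.mk a = 1 + PowerSeries.X * (PowerSeries.mk x * PowerSeries.mk a) := by
    ext n
    rcases n with _ | n
    · simp [h0]
    · rw [PowerSeries.coeff_mk, map_add, PowerSeries.coeff_succ_X_mul, PowerSeries.coeff_mul,
        h]
      simp [PowerSeries.coeff_one]
  linear_combination this

theorem coeffDeriv_X_mul_mk (x : ℕ → K[X]) :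
    coeffDeriv (PowerSeries.X * PowerSeries.mk x) =
      PowerSeries.X * PowerSeries.mk fun n => derivative (x n) := by
  ext1 n
  rcases n with _ | n
  · simp
  · simp [PowerSeries.coeff_succ_X_mul]

theorem map_X_mul_mk {R S : Type*} [CommRing R] [CommRing S] (φ : R →+* S) (x : ℕ → R) :
    (1 - PowerSeries.X * PowerSeries.mk x).map φ =
      1 - PowerSeries.X * PowerSeries.mk fun n => φ (x n) := by
  ext n
  rcases n with _ | n
  · simp
  · simp [PowerSeries.coeff_succ_X_mul, PowerSeries.coeff_one]

variable (h : CoupledSystem a b x y)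

include h

theorem map_eval_zero_one_sub :
    (1 - PowerSeries.X * PowerSeries.mk x).map (evalRingHom 0) = 1 := by
  rw [map_X_mul_mk]
  ext n
  rcases n with _ | n <;> simp [PowerSeries.coeff_succ_X_mul, h.eval_x]

variable [CharZero K]

/-- A conserved quantity: the derivative of the product is `-s(1-Y)/(1-Y) + s(1-X)/(1-X) = 0`, and
its value is read off at `0`, where `X` vanishes. -/
theorem one_sub_mul_one_sub :
    (1 - PowerSeries.X * PowerSeries.mk x) * (1 - PowerSeries.X * PowerSeries.mk y) =
      (1 - PowerSeries.X * PowerSeries.mk fun n => (y n).eval 0).map C := by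
  have hA := mk_mul_eq_one h.a_zero h.a_succ
  have hB := mk_mul_eq_one h.b_zero h.b_succ
  have h1 : coeffDeriv (1 : PowerSeries K[X]) = 0 := by
    simpa using coeffDeriv_map_C (1 : PowerSeries K)
  have hD : coeffDeriv ((1 - PowerSeries.X * PowerSeries.mk x) *
      (1 - PowerSeries.X * PowerSeries.mk y)) = 0 := by
    have ha : (PowerSeries.mk fun n => -a n) = -PowerSeries.mk a := by ext1 n; simp
    rw [coeffDeriv_mul, coeffDeriv_sub, coeffDeriv_sub, coeffDeriv_X_mul_mk, coeffDeriv_X_mul_mk,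
      h1]
    simp only [h.derivative_x, h.derivative_y]
    rw [ha]
    linear_combination PowerSeries.X * hA - PowerSeries.X * hB
  rw [eq_map_C_of_coeffDeriv_eq_zero hD 0, map_mul, map_X_mul_mk, map_X_mul_mk]
  congr 1
  have : (PowerSeries.mk fun n => (evalRingHom (0 : K)) (x n)) = 0 := by
    ext n
    simp [h.eval_x]
  rw [this]
  simp

theorem eval_y_zero (n : ℕ) : (y n).eval 0 = (x n).eval 1 := by
  have := congrArg (PowerSeries.map (evalRingHom (1 : K))) h.one_sub_mul_one_sub
  rw [map_evalRingHom_map_C, map_mul, map_X_mul_mk, map_X_mul_mk] at this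
  have hy : (PowerSeries.mk fun n => (evalRingHom (1 : K)) (y n)) = 0 := by
    ext n
    simp [h.eval_y]
  rw [hy, mul_zero, sub_zero, mul_one] at this
  have := congrArg (PowerSeries.coeff (n + 1)) this
  simpa [PowerSeries.coeff_succ_X_mul, PowerSeries.coeff_one] using this.symm

/-- Conservation gives `1/(1-Y) = (1-X)/c`, so the equation for `1 - X` becomes linear with a
coefficient independent of `u`. -/
theorem coeffDeriv_one_sub :
    coeffDeriv (1 - PowerSeries.X * PowerSeries.mk x) =
      -((PowerSeries.X * (1 - PowerSeries.X * PowerSeries.mk fun n => (y n).eval 0)⁻¹).map C *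
        (1 - PowerSeries.X * PowerSeries.mk x)) := by
  have hB := mk_mul_eq_one h.b_zero h.b_succ
  have hc := h.one_sub_mul_one_sub
  set c : PowerSeries K := 1 - PowerSeries.X * PowerSeries.mk fun n => (y n).eval 0
  have hc1 : c.map C * c⁻¹.map C = 1 := by
    rw [← map_mul, PowerSeries.mul_inv_cancel _ (by simp [c]), map_one]
  have h1 : coeffDeriv (1 : PowerSeries K[X]) = 0 := by
    simpa using coeffDeriv_map_C (1 : PowerSeries K)
  rw [coeffDeriv_sub, coeffDeriv_X_mul_mk, h1, map_mul, PowerSeries.map_X]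
  simp only [h.derivative_x]
  linear_combination PowerSeries.X * (PowerSeries.mk b) * hc1 +
    PowerSeries.X * c⁻¹.map C * (PowerSeries.mk b) * hc -
    PowerSeries.X * c⁻¹.map C * (1 - PowerSeries.X * PowerSeries.mk x) * hB

theorem map_eval_one_one_sub :
    (1 - PowerSeries.X * PowerSeries.mk x).map (evalRingHom 1) =
      1 - PowerSeries.X * PowerSeries.mk fun n => (y n).eval 0 := by
  rw [map_X_mul_mk]
  simp [h.eval_y_zero]

/-- `1 - Y₀ = exp(-s / (1 - Y₀))`, coefficient by coefficient. -/
theorem coeff_eq_finsum (n : ℕ) :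
    PowerSeries.coeff n (1 - PowerSeries.X * PowerSeries.mk fun n => (y n).eval 0) =
      ∑ᶠ k : ℕ, (-1) ^ k / (k.factorial : K) * PowerSeries.coeff n
        ((PowerSeries.X * (1 - PowerSeries.X * PowerSeries.mk fun n => (y n).eval 0)⁻¹) ^ k) := by
  have key := coeff_coeff_of_coeffDeriv_eq h.coeffDeriv_one_sub h.map_eval_zero_one_sub n
  simp only [← key]
  conv_lhs => rw [← h.map_eval_one_one_sub]
  -- The value of a polynomial at `1` is the finite sum of its coefficients, here those of the
  -- exponential.
  rw [PowerSeries.coeff_map, coe_evalRingHom, eval_eq_sum, Polynomial.sum]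
  simp only [one_pow, mul_one]
  exact (finsum_eq_sum_of_support_subset _ fun k hk => by simpa using hk).symm

/-- Since `f = 1 - X` is `exp(-us/c)`, one has `f(u-1) = c⁻¹ f(u)`: both sides solve the same linear
equation and equal `1` at `u = 1`. Substituting gives the delay equation `∂f(u) = -s f(u-1)`,
compared here coefficientwise. -/
theorem derivative_x_succ (n : ℕ) : derivative (x (n + 1)) = -(x n).comp (X - C 1) := by
  have hf := h.coeffDeriv_one_sub
  have hf1 := h.map_eval_one_one_sub
  have hf0 := h.map_eval_zero_one_sub
  set c : PowerSeries K := 1 - PowerSeries.X * PowerSeries.mk fun n => (y n).eval 0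
  set f : PowerSeries K[X] := 1 - PowerSeries.X * PowerSeries.mk x
  have hc1 : c⁻¹ * c = 1 := PowerSeries.inv_mul_cancel _ (by simp [c])
  have hg : coeffDeriv (f.map (compRingHom (X - C 1)) - c⁻¹.map C * f) =
      -((PowerSeries.X * c⁻¹).map C * (f.map (compRingHom (X - C 1)) - c⁻¹.map C * f)) := by
    have e : ∀ w : PowerSeries K, (w.map C).map (compRingHom (X - C 1)) = w.map C := by
      intro w; ext1 n; simp
    rw [coeffDeriv_sub, coeffDeriv_map_comp, coeffDeriv_mul, coeffDeriv_map_C, hf, map_neg,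
      map_mul, e]
    ring
  have hz := eq_zero_of_coeffDeriv_eq (by simp) hg 1 (by
    rw [map_sub, map_mul, map_evalRingHom_map_C, hf1, hc1, ← hf0, sub_eq_zero]
    ext n
    simp)
  have hfin : coeffDeriv f = -(PowerSeries.X * f.map (compRingHom (X - C 1))) := by
    rw [hf, map_mul, PowerSeries.map_X]
    linear_combination PowerSeries.X * hz
  have := congrArg (PowerSeries.coeff (n + 2)) hfin
  rw [coeff_coeffDeriv, map_neg, PowerSeries.coeff_succ_X_mul, PowerSeries.coeff_map] at this
  simp only [f, map_sub, PowerSeries.coeff_succ_X_mul, PowerSeries.coeff_one,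
    PowerSeries.coeff_mk] at this
  simp only [coe_compRingHom_apply] at this
  simpa [neg_eq_iff_eq_neg] using this

/-- The solution is given by Abel polynomials. -/
theorem x_eq (n : ℕ) :
    x n = C ((n + 1).factorial : K)⁻¹ * (X * (C (n + 1 : K) - X) ^ n) := by
  induction n with
  | zero =>
    refine eq_of_derivative_eq 0 ?_ (by simp [h.eval_x])
    simp [h.derivative_x, h.b_zero]
  | succ n ih =>
    refine eq_of_derivative_eq 0 ?_ (by simp [h.eval_x])
    rw [h.derivative_x_succ, ih, Nat.factorial_succ (n + 1)]
    have hn : ((n : K) + 1 + 1) ≠ 0 := by exact_mod_cast Nat.succ_ne_zero (n + 1)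
    -- The derivative of `u(n+2-u)ⁿ⁺¹` is `(n+2)(1-u)(n+2-u)ⁿ`, and this `n + 2` cancels against
    -- `(n+2)!`.
    have hC : (C (((n + 1 + 1) * (n + 1).factorial : ℕ) : K)⁻¹ : K[X]) * C ((n : K) + 1 + 1) =
        C ((n + 1).factorial : K)⁻¹ := by
      rw [← C_mul]
      push_cast
      field_simp
    rw [← hC]
    simp only [derivative_mul, derivative_C, derivative_X, derivative_pow,
      derivative_sub, mul_comp, C_comp, X_comp, pow_comp, sub_comp, Nat.add_sub_cancel]
    push_cast
    simp only [map_add, map_one, map_natCast]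
    ring

theorem eval_x_one (n : ℕ) : (x n).eval 1 = (n : K) ^ n / ((n + 1).factorial : K) := by
  rw [h.x_eq]
  simp [div_eq_inv_mul]

end CoupledSystem

end CoupledSystem

/-! ### Iterated integrals as polynomials -/

section IteratedIntegrals

variable {K : Type*} [Field K]

/-- The antiderivative of a polynomial that vanishes at `0`. -/
noncomputable def antideriv : K[X] →ₗ[K] K[X] :=
  Polynomial.lsum fun n => ((n : K) + 1)⁻¹ • monomial (n + 1)

theorem antideriv_monomial (n : ℕ) (c : K) :
    antideriv (monomial n c) = monomial (n + 1) (((n : K) + 1)⁻¹ * c) := by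
  rw [antideriv, lsum_apply, sum_monomial_index _ _ (by simp), LinearMap.smul_apply,
    smul_monomial, smul_eq_mul]

theorem derivative_antideriv [CharZero K] (p : K[X]) : derivative (antideriv p) = p := by
  induction p using Polynomial.induction_on' with
  | add p q hp hq => rw [map_add, derivative_add, hp, hq]
  | monomial n c =>
    have : (n : K) + 1 ≠ 0 := Nat.cast_add_one_ne_zero n
    rw [antideriv_monomial, derivative_monomial, Nat.add_sub_cancel]
    push_cast
    field_simp

theorem eval_zero_antideriv (p : K[X]) : (antideriv p).eval 0 = 0 := by
  induction p using Polynomial.induction_on' with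
  | add p q hp hq => rw [map_add, eval_add, hp, hq, add_zero]
  | monomial n c => simp [antideriv_monomial]

/-- The negative of the antiderivative of a polynomial, normalized to vanish at `1`. -/
noncomputable def coantideriv : K[X] →ₗ[K] K[X] where
  toFun p := C ((antideriv p).eval 1) - antideriv p
  map_add' p q := by simp only [map_add, eval_add]; ring
  map_smul' c p := by
    rw [map_smul, eval_smul, smul_eq_mul, C_mul, ← smul_eq_C_mul, RingHom.id_apply, smul_sub]

/-- The polynomials given by the iterated integrals; `true` stands for `φˣ`, `false` for `φʸ`. -/
noncomputable def polyIter : BinaryTree Unit → Bool → K[X]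
  | .nil, _ => 1
  | .node _ l r, true => antideriv (polyIter l false) * polyIter r true
  | .node _ l r, false => coantideriv (polyIter l true) * polyIter r false

theorem map_treeSum {M N : Type*} [AddCommMonoid M] [AddCommMonoid N] [Module K M] [Module K N]
    (φ : M →ₗ[K] N) (n : ℕ) (f : BinaryTree Unit → M) :
    φ (treeSum n f) = treeSum n fun t => φ (f t) :=
  map_sum φ _ _

theorem coupledSystem_polyIter [CharZero K] :
    CoupledSystem (fun n => treeSum n fun t => (polyIter t true : K[X]))
      (fun n => treeSum n fun t => polyIter t false)
      (fun n => antideriv (treeSum n fun t => polyIter t false))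
      (fun n => coantideriv (treeSum n fun t => polyIter t true)) where
  a_zero := by simp [treeSum_zero, polyIter]
  b_zero := by simp [treeSum_zero, polyIter]
  a_succ n := by simp only [treeSum_succ, map_treeSum, polyIter, treeSum_mul_treeSum]
  b_succ n := by simp only [treeSum_succ, map_treeSum, polyIter, treeSum_mul_treeSum]
  derivative_x n := derivative_antideriv _
  derivative_y n := by simp [coantideriv, derivative_antideriv]
  eval_x n := eval_zero_antideriv _
  eval_y n := by simp [coantideriv]

end IteratedIntegrals

theorem integral_eval (p : ℝ[X]) (u v : ℝ) :
    ∫ s in u..v, p.eval s = (antideriv p).eval v - (antideriv p).eval u := by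
  refine intervalIntegral.integral_eq_sub_of_hasDerivAt (f := fun s => (antideriv p).eval s)
    (fun s _ => ?_)
    (p.continuous.intervalIntegrable _ _)
  have := (antideriv p).hasDerivAt s
  rwa [derivative_antideriv] at this

theorem integral_indicator_Icc {u v : ℝ} (hu : 0 ≤ u) (huv : u ≤ v) (hv : v ≤ 1) (f : ℝ → ℝ) :
    ∫ s in (0 : ℝ)..1, (Set.Icc u v).indicator (fun _ => 1) s * f s = ∫ s in u..v, f s := by
  rw [intervalIntegral.integral_of_le zero_le_one, intervalIntegral.integral_of_le huv,
    MeasureTheory.integral_Ioc_eq_integral_Ioo, MeasureTheory.integral_Ioc_eq_integral_Ioo]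
  have h1 : ∀ s, (Set.Icc u v).indicator (fun _ => (1 : ℝ)) s * f s =
      (Set.Icc u v).indicator f s := fun s => by
    by_cases hs : s ∈ Set.Icc u v <;> simp [hs]
  simp only [h1]
  rw [← MeasureTheory.integral_Icc_eq_integral_Ioo, ← MeasureTheory.integral_Icc_eq_integral_Ioo,
    MeasureTheory.setIntegral_indicator measurableSet_Icc,
    Set.inter_eq_right.2 (Set.Icc_subset_Icc hu hv)]

/-- Agreement on `[0,1]` suffices for the induction, as every integration variable stays in that
interval. -/
theorem binaryIter_eq_eval (t : BinaryTree Unit) : ∀ u ∈ Set.Icc (0 : ℝ) 1,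
    binaryIter t kerX kerY u = (polyIter t true).eval u ∧
      binaryIter t kerY kerX u = (polyIter t false).eval u := by
  induction t with
  | nil => simp [binaryIter, polyIter]
  | node _ l r ihl ihr =>
    intro u hu
    have hcongr : ∀ (k f g : ℝ → ℝ), (∀ v ∈ Set.Icc (0 : ℝ) 1, f v = g v) →
        ∫ v in (0 : ℝ)..1, k v * f v = ∫ v in (0 : ℝ)..1, k v * g v := fun k f g h =>
      intervalIntegral.integral_congr fun v hv => by
        rw [Set.uIcc_of_le zero_le_one] at hv
        simp only [h v hv]
    simp only [binaryIter, polyIter, eval_mul, (ihr u hu).1, (ihr u hu).2]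
    rw [hcongr _ _ _ fun v hv => (ihl v hv).2, hcongr _ _ _ fun v hv => (ihl v hv).1]
    simp only [kerX, kerY]
    rw [integral_indicator_Icc le_rfl hu.1 hu.2, integral_indicator_Icc hu.1 hu.2 le_rfl,
      integral_eval, integral_eval]
    simp [coantideriv, eval_zero_antideriv]

/-! ### The series `s/(1-Y₀)` and the inverse of `G` -/

theorem Y₀_eq : Y₀ = PowerSeries.X * PowerSeries.mk fun n =>
    (coantideriv (treeSum n fun t => (polyIter t true : ℝ[X]))).eval 0 := by
  ext n
  rcases n with _ | n
  · rw [Y₀, coeff_zero_seriesY]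
    simp
  · rw [Y₀, coeff_seriesY, PowerSeries.coeff_succ_X_mul, PowerSeries.coeff_mk, map_treeSum,
      ← coe_evalRingHom, treeSum, treeSum, map_sum]
    refine Finset.sum_congr rfl fun t _ => ?_
    have h : ∫ v in (0 : ℝ)..1, kerY 0 v * binaryIter t kerX kerY v =
        ∫ v in (0 : ℝ)..1, kerY 0 v * (polyIter t true).eval v :=
      intervalIntegral.integral_congr fun v hv => by
        rw [Set.uIcc_of_le zero_le_one] at hv
        simp only [(binaryIter_eq_eval t v hv).1]
    rw [h]
    simp only [kerY]
    rw [integral_indicator_Icc le_rfl zero_le_one le_rfl, integral_eval]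
    simp [coantideriv]

theorem constantCoeff_Y₀ : PowerSeries.constantCoeff Y₀ = 0 := by
  rw [Y₀_eq]
  simp

/-- `1 - Y₀ = exp(-s / (1 - Y₀))`. -/
theorem one_sub_Y₀ : 1 - Y₀ = (PowerSeries.evalNegHom (PowerSeries.exp ℝ)).subst
    (PowerSeries.X * (1 - Y₀)⁻¹ : PowerSeries ℝ) := by
  ext n
  rw [PowerSeries.coeff_subst' (PowerSeries.HasSubst.of_constantCoeff_zero' (by simp)), Y₀_eq,
    coupledSystem_polyIter.coeff_eq_finsum]
  refine finsum_congr fun k => ?_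
  rw [PowerSeries.evalNegHom, PowerSeries.coeff_rescale, PowerSeries.coeff_exp]
  simp [div_eq_mul_inv]

theorem G_subst : G.subst (PowerSeries.X * (1 - Y₀)⁻¹ : PowerSeries ℝ) =
    (PowerSeries.X : PowerSeries ℝ) := by
  have hW : PowerSeries.HasSubst (PowerSeries.X * (1 - Y₀)⁻¹ : PowerSeries ℝ) :=
    PowerSeries.HasSubst.of_constantCoeff_zero' (by simp)
  rw [G, PowerSeries.subst_mul hW, PowerSeries.subst_X hW, ← one_sub_Y₀, mul_assoc,
    PowerSeries.inv_mul_cancel _ (by simp [constantCoeff_Y₀]), mul_one]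

/-- `W = s/(1-Y₀)` has linear coefficient `1`, hence a right compositional inverse `V`. Substituting
`V` into `G(W) = s` gives `G = V`, so `G` is a right inverse of `W` too. -/
theorem subst_G : (PowerSeries.X * (1 - Y₀)⁻¹ : PowerSeries ℝ).subst G =
    (PowerSeries.X : PowerSeries ℝ) := by
  have hW0 : PowerSeries.constantCoeff (PowerSeries.X * (1 - Y₀)⁻¹ : PowerSeries ℝ) = 0 := by simp
  have hW : PowerSeries.HasSubst (PowerSeries.X * (1 - Y₀)⁻¹ : PowerSeries ℝ) :=
    PowerSeries.HasSubst.of_constantCoeff_zero' hW0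
  have hu : IsUnit (PowerSeries.coeff 1 (PowerSeries.X * (1 - Y₀)⁻¹ : PowerSeries ℝ)) := by
    rw [show (1 : ℕ) = 0 + 1 from rfl, PowerSeries.coeff_succ_X_mul]
    simp [constantCoeff_Y₀]
  have hV := PowerSeries.HasSubst.substInvOfIsUnit _ hu
  have hr := PowerSeries.subst_substInvOfIsUnit_right _ hW0 hu
  have hG := congrArg (PowerSeries.subst
    (PowerSeries.substInvOfIsUnit (PowerSeries.X * (1 - Y₀)⁻¹ : PowerSeries ℝ) hu)) G_subst
  rw [PowerSeries.subst_comp_subst_apply hW hV, hr, PowerSeries.X_subst,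
    PowerSeries.subst_X hV] at hG
  rw [hG, hr]

/-! ### Cutting noncrossing pairings at the arc of the first point -/

section Arcs

variable {m : ℕ}

/-- The noncrossing involutions without fixed points of `{i, …, j-1}`, extended by the identity. -/
def arcs (m i j : ℕ) : Finset (Fin m → Fin m) :=
  Finset.univ.filter fun f =>
    (∀ x : Fin m, i ≤ x.val → x.val < j → i ≤ (f x).val ∧ (f x).val < j ∧ f x ≠ x ∧ f (f x) = x) ∧
    (∀ x : Fin m, ¬ (i ≤ x.val ∧ x.val < j) → f x = x) ∧
    ∀ x y : Fin m, ¬ (x < y ∧ y < f x ∧ f x < f y)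

/-- The restriction of `f` to `{i, …, j-1}`, extended by the identity. -/
def restrictArcs (f : Fin m → Fin m) (i j : ℕ) : Fin m → Fin m :=
  fun x => if i ≤ x.val ∧ x.val < j then f x else x

/-- Exchanges `i` and `k`, and coincides with `g` before and with `h` after `k`. -/
def joinArcs (i k : Fin m) (g h : Fin m → Fin m) : Fin m → Fin m :=
  fun x => if x = i then k else if x = k then i else if x < k then g x else h x

/-- An arc leaving the interval enclosed by the first arc would cross it, so the points inside and
those beyond `k` are each paired among themselves. -/
theorem arcs_maps_between {i k : Fin m} {j : ℕ} {f : Fin m → Fin m} (hf : f ∈ arcs m i j)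
    (hk : f i = k) (hij : i.val < j) :
    i < k ∧ k.val < j ∧ f k = i ∧ (∀ x, i < x → x < k → i < f x ∧ f x < k) ∧
      ∀ x, k < x → x.val < j → k < f x ∧ (f x).val < j := by
  simp only [arcs, Finset.mem_filter, Finset.mem_univ, true_and] at hf
  obtain ⟨h1, h2, h3⟩ := hf
  have hi := h1 i le_rfl hij
  rw [hk] at hi
  obtain ⟨hik, hkj, hne, hki⟩ := hi
  have hik : i < k := lt_of_le_of_ne hik (Ne.symm hne)
  have hin : ∀ x, i < x → x < k → i < f x ∧ f x < k := by
    intro x hx hxk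
    obtain ⟨a, b, c, d⟩ := h1 x (le_of_lt hx) (lt_trans hxk hkj)
    have := h3 i x
    rw [hk] at this
    have e1 : f x ≠ i := fun e => by rw [e, hk] at d; exact hxk.ne d.symm
    have e2 : f x ≠ k := fun e => by rw [e, hki] at d; exact hx.ne d
    refine ⟨lt_of_le_of_ne a (Ne.symm e1), lt_of_le_of_ne (not_lt.1 fun e => this ⟨hx, hxk, e⟩) e2⟩
  refine ⟨hik, hkj, hki, hin, fun x hx hxj => ?_⟩
  obtain ⟨a, b, c, d⟩ := h1 x (le_of_lt (hik.trans hx)) hxj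
  refine ⟨?_, b⟩
  by_contra e
  have e1 : f x ≠ i := fun e => by rw [e, hk] at d; exact hx.ne d
  have e2 : f x ≠ k := fun e => by rw [e, hki] at d; exact (hik.trans hx).ne d
  have := hin (f x) (lt_of_le_of_ne a (Ne.symm e1)) (lt_of_le_of_ne (not_lt.1 e) e2)
  rw [d] at this
  exact absurd this.2 hx.asymm

theorem restrictArcs_mem {i k : Fin m} {j : ℕ} {f : Fin m → Fin m} (hf : f ∈ arcs m i j)
    (hk : f i = k) (hij : i.val < j) :
    restrictArcs f (i + 1) k ∈ arcs m (i + 1) k ∧ restrictArcs f (k + 1) j ∈ arcs m (k + 1) j := by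
  obtain ⟨hik, hkj, hki, hin, hout⟩ := arcs_maps_between hf hk hij
  simp only [arcs, Finset.mem_filter, Finset.mem_univ, true_and] at hf ⊢
  obtain ⟨h1, h2, h3⟩ := hf
  simp only [Fin.lt_def] at *
  have key : ∀ i' j' : ℕ, i.val ≤ i' → j' ≤ j →
      (∀ x : Fin m, i' ≤ x.val → x.val < j' → i' ≤ (f x).val ∧ (f x).val < j') →
      (∀ x : Fin m, i' ≤ x.val → x.val < j' → i' ≤ (restrictArcs f i' j' x).val ∧
        (restrictArcs f i' j' x).val < j' ∧ restrictArcs f i' j' x ≠ x ∧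
        restrictArcs f i' j' (restrictArcs f i' j' x) = x) ∧
      (∀ x : Fin m, ¬ (i' ≤ x.val ∧ x.val < j') → restrictArcs f i' j' x = x) ∧
      ∀ x y : Fin m, ¬ (x.val < y.val ∧ y.val < (restrictArcs f i' j' x).val ∧
        (restrictArcs f i' j' x).val < (restrictArcs f i' j' y).val) := by
    intro i' j' hi' hj' hmaps
    refine ⟨fun x hx hx' => ?_, fun x hx => if_neg hx, fun x y => ?_⟩
    · have hm := hmaps x hx hx'
      have := h1 x (hi'.trans hx) (lt_of_lt_of_le hx' hj')
      simp only [restrictArcs, if_pos (And.intro hx hx'), if_pos hm]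
      exact ⟨hm.1, hm.2, this.2.2.1, this.2.2.2⟩
    · have := h3 x y
      simp only [restrictArcs]
      split_ifs <;> omega
  refine ⟨key _ _ (by omega) (by omega) fun x hx hx' => ?_,
    key _ _ (by omega) le_rfl fun x hx hx' => ?_⟩
  · have := hin x (by omega) hx'
    omega
  · have := hout x (by omega) hx'
    omega

theorem joinArcs_mem {i k : Fin m} {j : ℕ} {g h : Fin m → Fin m} (hik : i < k) (hkj : k.val < j)
    (hg : g ∈ arcs m (i + 1) k) (hh : h ∈ arcs m (k + 1) j) : joinArcs i k g h ∈ arcs m i j := by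
  simp only [arcs, Finset.mem_filter, Finset.mem_univ, true_and] at hg hh ⊢
  obtain ⟨g1, g2, g3⟩ := hg
  obtain ⟨h1, h2, h3⟩ := hh
  simp only [Fin.lt_def, Fin.ext_iff, ne_eq] at *
  refine ⟨fun x hx hx' => ?_, fun x hx => ?_, fun x y => ?_⟩
  · simp only [joinArcs, Fin.lt_def, Fin.ext_iff]
    have := g1 x
    have := h1 x
    split_ifs <;> omega
  · simp only [joinArcs, Fin.lt_def, Fin.ext_iff]
    have := g2 x
    have := h2 x
    split_ifs <;> omega
  · simp only [joinArcs, Fin.lt_def, Fin.ext_iff]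
    have := g3 x y
    have := h3 x y
    have := g1 x
    have := h1 x
    have := g1 y
    have := h1 y
    have := g2 x
    have := h2 x
    have := g2 y
    have := h2 y
    split_ifs <;> omega

theorem joinArcs_restrictArcs {i k : Fin m} {j : ℕ} {f : Fin m → Fin m} (hf : f ∈ arcs m i j)
    (hk : f i = k) (hij : i.val < j) :
    joinArcs i k (restrictArcs f (i + 1) k) (restrictArcs f (k + 1) j) = f := by
  obtain ⟨hik, hkj, hki, -, -⟩ := arcs_maps_between hf hk hij
  simp only [arcs, Finset.mem_filter, Finset.mem_univ, true_and] at hf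
  obtain ⟨-, h2, -⟩ := hf
  funext x
  simp only [Fin.lt_def] at *
  simp only [joinArcs, restrictArcs, Fin.lt_def]
  have := h2 x
  split_ifs with c1 c2 c3 c4 c5
  · rw [c1, hk]
  · rw [c2, hki]
  · rfl
  · exact (this (by rw [Fin.ext_iff] at c1 c2; omega)).symm
  · rfl
  · exact (this (by rw [Fin.ext_iff] at c1 c2; omega)).symm

theorem restrictArcs_joinArcs {i k : Fin m} {j : ℕ} {g h : Fin m → Fin m} (hik : i < k)
    (hg : g ∈ arcs m (i + 1) k) (hh : h ∈ arcs m (k + 1) j) :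
    restrictArcs (joinArcs i k g h) (i + 1) k = g ∧
      restrictArcs (joinArcs i k g h) (k + 1) j = h := by
  simp only [arcs, Finset.mem_filter, Finset.mem_univ, true_and] at hg hh
  constructor
  · funext x
    have := hg.2.1 x
    simp only [Fin.lt_def] at *
    simp only [joinArcs, restrictArcs, Fin.lt_def, Fin.ext_iff]
    split_ifs <;> omega
  · funext x
    have := hh.2.1 x
    simp only [Fin.lt_def] at *
    simp only [joinArcs, restrictArcs, Fin.lt_def, Fin.ext_iff]
    split_ifs <;> omega

end Arcs

/-! ### Sums of evaluations over noncrossing pairings -/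

section ArcSums

variable {A B : Type*} [Ring A] [Algebra ℂ A] [Ring B] [Algebra ℂ B]
  (ι : B →ₐ[ℂ] A) (κ : A →ₗ[ℂ] A →ₗ[ℂ] B) {m : ℕ}

/-- The evaluation of the part `a_i ⋯ a_{j-1}` of a word, parenthesized by a function. -/
def evalArcs (f : Fin m → Fin m) (a : ℕ → A) (i j : ℕ) : B :=
  if hi : i < m ∧ i < j then
    if i < (f ⟨i, hi.1⟩).val ∧ (f ⟨i, hi.1⟩).val < j then
      κ (a i) (ι (evalArcs f a (i + 1) (f ⟨i, hi.1⟩).val) * a (f ⟨i, hi.1⟩).val) *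
        evalArcs f a ((f ⟨i, hi.1⟩).val + 1) j
    else 0
  else 1
termination_by j - i
decreasing_by all_goals omega

theorem evalWord_eq_evalArcs (σ : Equiv.Perm (Fin m)) (a : ℕ → A) (i j : ℕ) :
    evalWord ι κ σ (fun x : Fin m => a x) i j = evalArcs ι κ σ a i j := by
  induction hk : j - i using Nat.strong_induction_on generalizing i j with
  | _ k ih =>
  rw [evalWord, evalArcs]
  by_cases hi : i < m ∧ i < j
  · rw [dif_pos hi, dif_pos hi]
    by_cases h : i < (σ ⟨i, hi.1⟩).val ∧ (σ ⟨i, hi.1⟩).val < j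
    · rw [if_pos h, if_pos h, ih _ (by omega) _ _ rfl, ih _ (by omega) _ _ rfl]
    · rw [if_neg h, if_neg h]
  · rw [dif_neg hi, dif_neg hi]

theorem evalArcs_congr {f g : Fin m → Fin m} (a : ℕ → A) (i j : ℕ)
    (h : ∀ x : Fin m, i ≤ x.val → x.val < j → f x = g x) :
    evalArcs ι κ f a i j = evalArcs ι κ g a i j := by
  induction hk : j - i using Nat.strong_induction_on generalizing i j with
  | _ k ih =>
  rw [evalArcs, evalArcs]
  by_cases hi : i < m ∧ i < j
  · rw [dif_pos hi, dif_pos hi, h ⟨i, hi.1⟩ le_rfl hi.2]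
    by_cases hc : i < (g ⟨i, hi.1⟩).val ∧ (g ⟨i, hi.1⟩).val < j
    · rw [if_pos hc, if_pos hc,
        ih _ (by omega) _ _ (fun x hx hx' => h x (by omega) (by omega)) rfl,
        ih _ (by omega) _ _ (fun x hx hx' => h x (by omega) (by omega)) rfl]
    · rw [if_neg hc, if_neg hc]
  · rw [dif_neg hi, dif_neg hi]

/-- The sum over all noncrossing pairings of the part `a_i ⋯ a_{j-1}` of a word. -/
def arcSum (m : ℕ) (a : ℕ → A) (i j : ℕ) : B := ∑ f ∈ arcs m i j, evalArcs ι κ f a i j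

theorem sum_noncrossing (a : ℕ → A) :
    ∑ σ ∈ noncrossing m, kappaPerm ι κ σ (fun x : Fin m => a x) = arcSum ι κ m a 0 m := by
  refine Finset.sum_bij (fun σ _ => ⇑σ) (fun σ hσ => ?_) (fun _ _ _ _ h => DFunLike.coe_injective h)
    (fun f hf => ?_) (fun σ _ => evalWord_eq_evalArcs ι κ σ a 0 m)
  · simp only [noncrossing, arcs, Finset.mem_filter, Finset.mem_univ, true_and] at hσ ⊢
    exact ⟨fun x _ _ => ⟨Nat.zero_le _, (σ x).isLt, hσ.2.1 x, hσ.1 x⟩,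
      fun x hx => absurd ⟨Nat.zero_le _, x.isLt⟩ hx, hσ.2.2⟩
  · simp only [arcs, Finset.mem_filter, Finset.mem_univ, true_and] at hf
    have h1 := fun x : Fin m => hf.1 x (Nat.zero_le _) x.isLt
    have hinv : Function.Involutive f := fun x => (h1 x).2.2.2
    refine ⟨hinv.toPerm, ?_, rfl⟩
    simp only [noncrossing, Finset.mem_filter, Finset.mem_univ, true_and]
    exact ⟨hinv, fun x => (h1 x).2.2.1, hf.2.2⟩

theorem arcSum_self (a : ℕ → A) (i : ℕ) : arcSum ι κ m a i i = 1 := by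
  have : arcs m i i = {id} := by
    ext f
    simp only [arcs, Finset.mem_filter, Finset.mem_univ, true_and, Finset.mem_singleton]
    constructor
    · exact fun h => funext fun x => h.2.1 x (by omega)
    · rintro rfl
      refine ⟨fun x _ _ => by omega, fun _ _ => rfl, fun x y h => ?_⟩
      exact absurd h.1 (lt_asymm h.2.1)
  rw [arcSum, this, Finset.sum_singleton, evalArcs, dif_neg (by omega)]

/-- Decomposition of the noncrossing pairings by the partner of the first letter. -/
theorem arcSum_eq_sum (a : ℕ → A) {i j : ℕ} (hij : i < j) (hj : j ≤ m) :
    arcSum ι κ m a i j = ∑ k ∈ Finset.Ioo i j,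
      κ (a i) (ι (arcSum ι κ m a (i + 1) k) * a k) * arcSum ι κ m a (k + 1) j := by
  let i' : Fin m := ⟨i, by omega⟩
  rw [arcSum, ← Finset.sum_fiberwise_of_maps_to (t := Finset.Ioo i j) (g := fun f => (f i').val)]
  · refine Finset.sum_congr rfl fun k hk => ?_
    obtain ⟨hik, hkj⟩ := Finset.mem_Ioo.1 hk
    let k' : Fin m := ⟨k, by omega⟩
    have hik' : i' < k' := hik
    have hkj' : k'.val < j := hkj
    -- Pairings with `i` joined to `k` correspond to pairs of pairings inside and beyond the arc;
    -- the value factors, and bilinearity of `κ` carries the two sums inside.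
    calc _ = ∑ gh ∈ arcs m (i + 1) k ×ˢ arcs m (k + 1) j,
          κ (a i) (ι (evalArcs ι κ gh.1 a (i + 1) k) * a k) * evalArcs ι κ gh.2 a (k + 1) j := by
          refine Finset.sum_bij' (fun f _ => (restrictArcs f (i + 1) k, restrictArcs f (k + 1) j))
            (fun gh _ => joinArcs i' k' gh.1 gh.2) ?_ ?_ ?_ ?_ ?_
          · intro f hf
            obtain ⟨hf, hfk⟩ := Finset.mem_filter.1 hf
            have := restrictArcs_mem (i := i') (k := k') hf (Fin.ext hfk) hij
            exact Finset.mem_product.2 this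
          · rintro ⟨g, h⟩ hgh
            obtain ⟨hg, hh⟩ := Finset.mem_product.1 hgh
            refine Finset.mem_filter.2 ⟨joinArcs_mem hik' hkj' hg hh, ?_⟩
            simp [joinArcs, k']
          · intro f hf
            obtain ⟨hf, hfk⟩ := Finset.mem_filter.1 hf
            exact joinArcs_restrictArcs (i := i') (k := k') hf (Fin.ext hfk) hij
          · rintro ⟨g, h⟩ hgh
            obtain ⟨hg, hh⟩ := Finset.mem_product.1 hgh
            have := restrictArcs_joinArcs hik' hg hh
            exact Prod.ext this.1 this.2
          · intro f hf
            obtain ⟨hf, hfk⟩ := Finset.mem_filter.1 hf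
            have hfk : (f ⟨i, by omega⟩).val = k := hfk
            rw [evalArcs, dif_pos ⟨by omega, hij⟩, if_pos (by omega)]
            simp only [hfk]
            rw [evalArcs_congr ι κ (f := restrictArcs f (i + 1) k) a (i + 1) k
                fun x hx hx' => if_pos ⟨hx, hx'⟩,
              evalArcs_congr ι κ (f := restrictArcs f (k + 1) j) a (k + 1) j
                fun x hx hx' => if_pos ⟨hx, hx'⟩]
      _ = _ := by
          rw [Finset.sum_product]
          simp only [arcSum, map_sum, Finset.sum_mul, Finset.mul_sum]
          exact Finset.sum_comm
  · intro f hf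
    have := arcs_maps_between (i := i') hf rfl hij
    exact Finset.mem_Ioo.2 ⟨this.1, this.2.1⟩

end ArcSums

/-! ### The alternating word -/

section Alternating

/-- Positions at even distance carry equal letters, whose covariance vanishes; only partners at odd
distance remain. -/
theorem sum_Ioo_alternating {M : Type*} [AddCommMonoid M] (i n : ℕ) (g : ℕ → M)
    (hg : ∀ r, g (i + 2 * r) = 0) :
    ∑ k ∈ Finset.Ioo i (i + 2 * (n + 1)), g k =
      ∑ rq ∈ Finset.HasAntidiagonal.antidiagonal n, g (i + 1 + 2 * rq.1) := by
  rw [Finset.Nat.sum_antidiagonal_eq_sum_range_succ fun r _ => g (i + 1 + 2 * r)]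
  induction n with
  | zero =>
    have : Finset.Ioo i (i + 2 * (0 + 1)) = {i + 1} := by
      ext k; simp only [Finset.mem_Ioo, Finset.mem_singleton]; omega
    simp [this]
  | succ n ih =>
    have : Finset.Ioo i (i + 2 * (n + 1 + 1)) =
        insert (i + 1 + 2 * (n + 1)) (insert (i + 2 * (n + 1)) (Finset.Ioo i (i + 2 * (n + 1)))) := by
      ext k; simp only [Finset.mem_Ioo, Finset.mem_insert]; omega
    rw [this, Finset.sum_insert (by simp), Finset.sum_insert (by simp), hg, zero_add, ih,
      Finset.sum_range_succ _ (n + 1), add_comm]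

variable {A : Type*} [Ring A] [StarRing A]

/-- The alternating word `T T* T T* ⋯`. -/
def altWord (T : A) (x : ℕ) : A := letter T (decide (x % 2 = 1))

theorem altWord_even (T : A) (x : ℕ) : altWord T (2 * x) = T := by
  simp [altWord, letter]

theorem altWord_odd (T : A) (x : ℕ) : altWord T (2 * x + 1) = star T := by
  simp [altWord, letter, Nat.add_mod]

theorem prod_altWord (T : A) (n : ℕ) :
    (List.ofFn fun x : Fin (2 * n) => altWord T x).prod = (T * star T) ^ n := by
  have h : (List.finRange (2 * n)).map (fun x : Fin (2 * n) => altWord T x) =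
      (List.range (2 * n)).map (altWord T) := by
    rw [← List.map_coe_finRange_eq_range, List.map_map]
    rfl
  rw [List.ofFn_eq_map, h]
  clear h
  induction n with
  | zero => simp
  | succ n ih =>
    rw [mul_add, mul_one, List.range_succ, List.range_succ]
    simp only [List.map_append, List.prod_append, ih, List.map_cons, List.map_nil,
      List.prod_singleton, altWord_even, altWord_odd]
    rw [pow_succ, mul_assoc]

variable [Algebra ℂ A]

/-- Inside the first arc the word starts with the opposite letter, beyond it with the same letter.
So subwords starting with `T` and with `T*` satisfy the recursions of `b` and `a` in
`CoupledSystem`, the two covariances playing the roles of `coantideriv` and `antideriv`. -/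
theorem arcSum_altWord (ι : ℂ[X] →ₐ[ℂ] A) (κ : A →ₗ[ℂ] A →ₗ[ℂ] ℂ[X]) (T : A)
    (h1 : ∀ b, κ T (ι b * star T) = coantideriv b) (h2 : ∀ b, κ (star T) (ι b * T) = antideriv b)
    (h3 : ∀ b, κ T (ι b * T) = 0) (h4 : ∀ b, κ (star T) (ι b * star T) = 0) (m n i : ℕ) :
    (2 * i + 2 * n ≤ m → arcSum ι κ m (altWord T) (2 * i) (2 * i + 2 * n) =
      treeSum n fun t => polyIter t false) ∧
    (2 * i + 1 + 2 * n ≤ m → arcSum ι κ m (altWord T) (2 * i + 1) (2 * i + 1 + 2 * n) =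
      treeSum n fun t => polyIter t true) := by
  have hS := coupledSystem_polyIter (K := ℂ)
  induction n using Nat.strong_induction_on generalizing i with
  | _ n ih =>
  rcases n with _ | n
  · simp only [mul_zero, add_zero, arcSum_self]
    exact ⟨fun _ => hS.b_zero.symm, fun _ => hS.a_zero.symm⟩
  · constructor
    · intro hm
      rw [arcSum_eq_sum ι κ _ (by omega) hm, sum_Ioo_alternating, hS.b_succ n]
      · refine Finset.sum_congr rfl fun rq hrq => ?_
        have hrq := Finset.HasAntidiagonal.mem_antidiagonal.1 hrq
        have e1 := (ih rq.1 (by omega) i).2 (by omega)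
        have e2 := (ih rq.2 (by omega) (i + 1 + rq.1)).1 (by omega)
        rw [e1, altWord_even, show 2 * i + 1 + 2 * rq.1 = 2 * (i + rq.1) + 1 by ring, altWord_odd,
          h1, ← e2]
        congr 2 <;> omega
      · intro r
        rw [← mul_add, altWord_even, altWord_even, h3, zero_mul]
    · intro hm
      rw [arcSum_eq_sum ι κ _ (by omega) hm, sum_Ioo_alternating, hS.a_succ n]
      · refine Finset.sum_congr rfl fun rq hrq => ?_
        have hrq := Finset.HasAntidiagonal.mem_antidiagonal.1 hrq
        have e1 := (ih rq.1 (by omega) (i + 1)).1 (by omega)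
        have e2 := (ih rq.2 (by omega) (i + 1 + rq.1)).2 (by omega)
        rw [show 2 * i + 1 + 1 = 2 * (i + 1) by ring, e1, altWord_odd, ← mul_add, altWord_even,
          h2, ← e2]
        congr 2; omega
      · intro r
        rw [show 2 * i + 1 + 2 * r = 2 * (i + r) + 1 by ring, altWord_odd, altWord_odd, h4,
          zero_mul]

end Alternating

/-! ### Moments of the triangular operator -/

theorem integral_eval_complex (p : ℂ[X]) (u v : ℝ) :
    ∫ s in u..v, p.eval (s : ℂ) = (antideriv p).eval (v : ℂ) - (antideriv p).eval (u : ℂ) := by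
  refine intervalIntegral.integral_eq_sub_of_hasDerivAt
    (f := fun s : ℝ => (antideriv p).eval (s : ℂ)) (fun s _ => ?_)
    ((p.continuous.comp Complex.continuous_ofReal).intervalIntegrable _ _)
  have := (antideriv p).hasDerivAt (s : ℂ)
  rw [derivative_antideriv] at this
  exact this.comp_ofReal

/-- The covariance is prescribed only on `[0,1]`; infinitely many points upgrade this to identities
of polynomials. -/
theorem eq_of_eval_unitInterval {p q : ℂ[X]}
    (h : ∀ x ∈ Set.Icc (0 : ℝ) 1, p.eval (x : ℂ) = q.eval (x : ℂ)) : p = q := by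
  refine Polynomial.eq_of_infinite_eval_eq p q (Set.Infinite.mono ?_
    ((Set.Icc_infinite (zero_lt_one' ℝ)).image Complex.ofReal_injective.injOn))
  rintro _ ⟨x, hx, rfl⟩
  exact h x hx

theorem condExp_pow {A : Type*} [Ring A] [StarRing A] [Algebra ℂ A]
    {ι : ℂ[X] →ₐ[ℂ] A} {E : A →ₗ[ℂ] ℂ[X]} {T : A} (hT : IsTriangular ι E T) (n : ℕ) :
    E ((T * star T) ^ n) = treeSum n fun t => polyIter t false := by
  obtain ⟨κ, hc, h1, h2, h3, h4⟩ := hT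
  have hw : (word ι T (fun _ : Fin (2 * n) => 1) fun x => decide (x.val % 2 = 1)) =
      fun x : Fin (2 * n) => altWord T x := by
    funext x
    simp [word, altWord]
  have he := hc.even n (fun _ => 1) fun x => decide (x.val % 2 = 1)
  rw [hw, prod_altWord, sum_noncrossing] at he
  have h1' : ∀ b, κ T (ι b * star T) = coantideriv b := fun b =>
    eq_of_eval_unitInterval fun x hx => by
      rw [h1 b x hx, integral_eval_complex]
      simp [coantideriv]
  have h2' : ∀ b, κ (star T) (ι b * T) = antideriv b := fun b =>
    eq_of_eval_unitInterval fun x hx => by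
      rw [h2 b x hx, integral_eval_complex]
      simp [eval_zero_antideriv]
  have := (arcSum_altWord ι κ T h1' h2' h3 h4 (2 * n) n 0).1 (by omega)
  rw [he]
  simpa using this

/-- `E((TT*)ⁿ)` is the derivative of `x n`, which vanishes at `0`, so the trace is the value of `x
n` at `1`. -/
theorem trace_pow {A : Type*} [Ring A] [StarRing A] [Algebra ℂ A]
    {ι : ℂ[X] →ₐ[ℂ] A} {E : A →ₗ[ℂ] ℂ[X]} {T : A} (hT : IsTriangular ι E T) (n : ℕ) :
    trace E ((T * star T) ^ n) = (n : ℂ) ^ n / ((n + 1).factorial : ℂ) := by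
  rw [trace, condExp_pow hT, integral_eval_complex, ← coupledSystem_polyIter.eval_x_one]
  simp [eval_zero_antideriv]

end DykemaHaagerup

theorem lemma3 :
    (PowerSeries.constantCoeff DykemaHaagerup.Y₀ = 0 ∧
      DykemaHaagerup.G.subst (PowerSeries.X * (1 - DykemaHaagerup.Y₀)⁻¹) =
        (PowerSeries.X : PowerSeries ℝ) ∧
      (PowerSeries.X * (1 - DykemaHaagerup.Y₀)⁻¹).subst DykemaHaagerup.G =
        (PowerSeries.X : PowerSeries ℝ)) ∧
    ∀ (A : Type*) [Ring A] [StarRing A] [Algebra ℂ A] [StarModule ℂ A]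
      (ι : Polynomial ℂ →ₐ[ℂ] A) (E : A →ₗ[ℂ] Polynomial ℂ) (T : A),
      DykemaHaagerup.IsPolyProbSpace ι E → DykemaHaagerup.IsTriangular ι E T →
      ∀ n : ℕ, DykemaHaagerup.trace E ((T * star T) ^ n) =
        (n : ℂ) ^ n / ((n + 1).factorial : ℂ) := by
  refine ⟨⟨DykemaHaagerup.constantCoeff_Y₀, DykemaHaagerup.G_subst, DykemaHaagerup.subst_G⟩, ?_⟩
  intro A _ _ _ _ ι E T _ hT n
  exact DykemaHaagerup.trace_pow hT n
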